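/- Let $\Phi$ be a reduced crystallographic root system, not necessarily irreducible, spanning a Euclidean space $V$, with simple system $S$ and positive system $\Phi^+$, and let $k$ be a positive integer. For $\alpha\in\Phi$ and $r\in\mathbb Z$ put $H_\alpha^r=\{x\in V\mid\langle x,\alpha\rangle=r\}$. *Regions and alcoves.* The regions of the $k$-Catalan arrangement are the connected components of the complement of all $H_\alpha^r$ with $\alpha\in\Phi$, $r\in\{0,1,\dots,k\}$; a region $R$ is dominant if $\langle x,\alpha\rangle>0$ for all $x\in R$, $\alpha\in\Phi^+$. The alcoves are the connected components of the complement of all $H_\alpha^r$ with $\alpha\in\Phi$, $r\in\mathbb Z$. A wall of a region (or alcove) is a hyperplane supporting one of its facets. A floor of a dominant region $R$ is a wall of $R$ that does not contain the origin and separates $R$ from the origin; a ceiling of $R$ is a wall of $R$ that does not contain the origin and has $R$ and the origin on the same side. The affine Weyl group $W_a$ is generated by the reflections in all $H_\alpha^r$ ($\alpha\in\Phi$, $r\in\mathbb Z$); its Coxeter generators $S_a$ are the reflections in the walls of the fundamental alcove $\{x\mid 0<\langle x,\alpha\rangle<1\text{ for all }\alpha\in\Phi^+\}$, and a parabolic subgroup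 of $W_a$ is a $W_a$-conjugate of a subgroup generated by a subset of $S_a$. *Minimal and pseudomaximal alcoves.* For a dominant region $R$ and $0\le i\le k$ let $I_i=\{\alpha\in\Phi^+\mid\langle x,\alpha\rangle<i\text{ for all }x\in R\}$ and $J_i=\{\alpha\in\Phi^+\mid\langle x,\alpha\rangle>i\text{ for all }x\in R\}$. For $\alpha\in\Phi^+$ let $k_\alpha$ be the maximum of $c_1+\dots+c_m$ over all expressions $\alpha=\alpha_1+\dots+\alpha_m$ with $c_j\in\{0,\dots,k\}$ and $\alpha_j\in J_{c_j}$. The minimal alcove of $R$ is $$A(R)=\{x\in V\mid k_\alpha<\langle x,\alpha\rangle<k_\alpha+1\text{ for all }\alpha\in\Phi^+\}.$$ Let $\underline I_i=I_i$ for $i\le k$ and $\underline I_{k+1}=\bigcup_{i+j=k+1,\ i,j\ge1}\big((I_i+I_j)\cap\Phi^+\big)\cup I_k\cup S$, and for $\alpha\in\Phi^+$ let $r_\alpha$ be the minimum of $c_1+\dots+c_m$ over all expressions $\alpha=\alpha_1+\dots+\alpha_m$ with $c_j\in\{0,\dots,k+1\}$ and $\alpha_j\in\underline I_{c_j}$.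 The pseudomaximal alcove of $R$ is $$B(R)=\{x\in V\mid r_\alpha-1<\langle x,\alpha\rangle<r_\alpha\text{ for all }\alpha\in\Phi^+\}.$$ **Theorem.** Let $M=\{H_{\alpha_1}^{i_1},\dots,H_{\alpha_m}^{i_m}\}$ be any set of $m$ hyperplanes with $\alpha_j\in\Phi^+$ and $i_j\in\{1,\dots,k\}$. Let $U(M)$ be the set of dominant regions of the $k$-Catalan arrangement having every hyperplane of $M$ as a floor, and $L(M)$ the set of those having every hyperplane of $M$ as a ceiling. Then there is a bijection $\Theta:U(M)\to L(M)$, which, whenever $U(M)\neq\varnothing$, is given explicitly as follows. The group $W'$ generated by the set $S'$ of reflections in the hyperplanes of $M$ is a finite parabolic subgroup of $W_a$, and it has a unique element $w_0'$ of maximal length with respect to $S'$. For every $R\in U(M)$, the set $A(R)$ is an alcove contained in $R$, the set $w_0'(A(R))$ is an alcove, and $\Theta(R)$ is the region containing it. For every $R'\in L(M)$, the set $B(R')$ is an alcove contained in $R'$, the set $w_0'(B(R'))$ is an alcove, and $\Theta^{-1}(R')$ is the region containing it. -/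

import Mathlib

open scoped InnerProductSpace

noncomputable section

namespace CatalanArrangement

variable {ι V N : Type*} [NormedAddCommGroup V] [InnerProductSpace ℝ V]
  [AddCommGroup N] [Module ℝ N]

/-- The root pairing lives in the Euclidean space `V`: each reflection `s_α` is orthogonal, so it is
the orthogonal reflection in the hyperplane perpendicular to `α`. -/
def IsEuclidean (P : RootPairing ι ℝ V N) : Prop :=
  ∀ (i : ι) (x y : V), ⟪P.reflection i x, P.reflection i y⟫_ℝ = ⟪x, y⟫_ℝ

/-! ### Hyperplanes, regions, alcoves -/

/-- The affine hyperplane `H_α^r = {x | ⟨x, α⟩ = r}`. -/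
def hyperplane (P : RootPairing ι ℝ V N) (α : ι) (r : ℤ) : Set V :=
  {x | ⟪x, P.root α⟫_ℝ = r}

/-- The union of the hyperplanes of the `k`-Catalan arrangement: `H_α^r` for `α` a root (positive or
negative) and `r ∈ {0, …, k}`. -/
def catalanArrangement (P : RootPairing ι ℝ V N) (k : ℕ) : Set V :=
  {x | ∃ (α : ι) (r : ℤ), 0 ≤ r ∧ r ≤ k ∧ x ∈ hyperplane P α r}

/-- The union of the hyperplanes of the affine Coxeter arrangement: `H_α^r` for `α` a root and
`r ∈ ℤ`. -/
def affineArrangement (P : RootPairing ι ℝ V N) : Set V :=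
  {x | ∃ (α : ι) (r : ℤ), x ∈ hyperplane P α r}

/-- `C` is a connected component of the set `F`. -/
def IsComponentOf (C F : Set V) : Prop :=
  ∃ x ∈ F, C = connectedComponentIn F x

/-- A region of the `k`-Catalan arrangement. -/
def IsRegion (P : RootPairing ι ℝ V N) (k : ℕ) (R : Set V) : Prop :=
  IsComponentOf R (catalanArrangement P k)ᶜ

/-- An alcove. -/
def IsAlcove (P : RootPairing ι ℝ V N) (A : Set V) : Prop :=
  IsComponentOf A (affineArrangement P)ᶜ

/-- A dominant region of the `k`-Catalan arrangement. -/
def IsDominantRegion {P : RootPairing ι ℝ V N} (b : P.Base) (k : ℕ) (R : Set V) : Prop :=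
  IsRegion P k R ∧ ∀ α, b.IsPos α → ∀ x ∈ R, 0 < ⟪x, P.root α⟫_ℝ

/-! ### Walls, floors, ceilings -/

/-- `H_α^r` supports a facet of `R` (a region or an alcove): it does not meet `R`, and the face
`closure R ∩ H_α^r` spans all of `H_α^r` affinely. -/
def IsWall (P : RootPairing ι ℝ V N) (R : Set V) (α : ι) (r : ℤ) : Prop :=
  Disjoint R (hyperplane P α r) ∧
    (affineSpan ℝ (closure R ∩ hyperplane P α r) : Set V) = hyperplane P α r

/-- `H_α^r` (with `r > 0`, so that the origin lies in `⟨x, α⟩ < r`) is a floor of `R`: a wall that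
separates `R` from the origin. -/
def IsFloor (P : RootPairing ι ℝ V N) (R : Set V) (α : ι) (r : ℕ) : Prop :=
  0 < r ∧ IsWall P R α r ∧ ∀ x ∈ R, (r : ℝ) < ⟪x, P.root α⟫_ℝ

/-- `H_α^r` (with `r > 0`, so that the origin lies in `⟨x, α⟩ < r`) is a ceiling of `R`: a wall that
has `R` and the origin on the same side. -/
def IsCeiling (P : RootPairing ι ℝ V N) (R : Set V) (α : ι) (r : ℕ) : Prop :=
  0 < r ∧ IsWall P R α r ∧ ∀ x ∈ R, ⟪x, P.root α⟫_ℝ < (r : ℝ)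

/-- `U(M)`: the dominant regions that have every hyperplane of `M` as a floor. The pair `(α, i)` in
`M` stands for the hyperplane `H_α^i`. -/
def regionsAbove {P : RootPairing ι ℝ V N} (b : P.Base) (k : ℕ) (M : Set (ι × ℕ)) :
    Set (Set V) :=
  {R | IsDominantRegion b k R ∧ ∀ p ∈ M, IsFloor P R p.1 p.2}

/-- `L(M)`: the dominant regions that have every hyperplane of `M` as a ceiling. -/
def regionsBelow {P : RootPairing ι ℝ V N} (b : P.Base) (k : ℕ) (M : Set (ι × ℕ)) :
    Set (Set V) :=
  {R | IsDominantRegion b k R ∧ ∀ p ∈ M, IsCeiling P R p.1 p.2}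

/-! ### Affine reflections, parabolic subgroups, longest elements -/

/-- The orthogonal reflection `s_α^r` in the hyperplane `H_α^r`. -/
def affineReflection (P : RootPairing ι ℝ V N) (α : ι) (r : ℤ) : Equiv.Perm V :=
  Function.Involutive.toPerm
    (fun x => x - (2 * (⟪x, P.root α⟫_ℝ - r) / ⟪P.root α, P.root α⟫_ℝ) • P.root α) <| by
      intro x
      by_cases h : ⟪P.root α, P.root α⟫_ℝ = 0
      · simp [inner_self_eq_zero.mp h]
      · simp only [inner_sub_left, real_inner_smul_left]
        rw [sub_sub, ← add_smul]
        convert sub_zero x using 2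
        convert zero_smul ℝ (P.root α) using 2
        field_simp
        ring

/-- The affine Weyl group `W_a`, as a group of transformations of `V`. -/
def affineWeylGroup (P : RootPairing ι ℝ V N) : Subgroup (Equiv.Perm V) :=
  Subgroup.closure {s | ∃ (α : ι) (r : ℤ), s = affineReflection P α r}

/-- The fundamental alcove. -/
def fundamentalAlcove {P : RootPairing ι ℝ V N} (b : P.Base) : Set V :=
  {x | ∀ α, b.IsPos α → 0 < ⟪x, P.root α⟫_ℝ ∧ ⟪x, P.root α⟫_ℝ < 1}

/-- The Coxeter generators `S_a` of `W_a`: the reflections in the walls of the fundamental alcove. -/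
def simpleAffineReflections {P : RootPairing ι ℝ V N} (b : P.Base) : Set (Equiv.Perm V) :=
  {s | ∃ (α : ι) (r : ℤ), IsWall P (fundamentalAlcove b) α r ∧ s = affineReflection P α r}

/-- `G` is a parabolic subgroup of `W_a`: a `W_a`-conjugate of a subgroup generated by a subset of
`S_a`. -/
def IsParabolic {P : RootPairing ι ℝ V N} (b : P.Base) (G : Subgroup (Equiv.Perm V)) : Prop :=
  ∃ w ∈ affineWeylGroup P, ∃ J ⊆ simpleAffineReflections b,
    G = Subgroup.closure ((fun s => w * s * w⁻¹) '' J)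

/-- The set of reflections in the hyperplanes of `M`. -/
def reflectionsIn (P : RootPairing ι ℝ V N) (M : Set (ι × ℕ)) : Set (Equiv.Perm V) :=
  (fun p : ι × ℕ => affineReflection P p.1 p.2) '' M

/-- The word length of `w` with respect to `S`: the least number of factors in an expression of `w`
as a product of elements of `S`. (Used only for sets `S` of involutions and `w` in the group
generated by `S`, where such an expression exists.) -/
def wordLength {G : Type*} [Group G] (S : Set G) (w : G) : ℕ :=
  sInf {n | ∃ l : List G, (∀ s ∈ l, s ∈ S) ∧ l.prod = w ∧ l.length = n}

/-- `w` is an element of maximal length of the group generated by `S`. -/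
def IsLongest {G : Type*} [Group G] (S : Set G) (w : G) : Prop :=
  w ∈ Subgroup.closure S ∧ ∀ v ∈ Subgroup.closure S, wordLength S v ≤ wordLength S w

/-! ### Minimal and pseudomaximal alcoves -/

/-- The ideals `I_i` of the chain `θ(R)`. -/
def idealChain {P : RootPairing ι ℝ V N} (b : P.Base) (R : Set V) (i : ℕ) : Set ι :=
  {α | b.IsPos α ∧ ∀ x ∈ R, ⟪x, P.root α⟫_ℝ < (i : ℝ)}

/-- The order filters `J_i` of the chain `φ(R)`. -/
def filterChain {P : RootPairing ι ℝ V N} (b : P.Base) (R : Set V) (i : ℕ) : Set ι :=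
  {α | b.IsPos α ∧ ∀ x ∈ R, (i : ℝ) < ⟪x, P.root α⟫_ℝ}

/-- The sums `c_1 + ⋯ + c_m` over all expressions `α = α_1 + ⋯ + α_m` with `α_j ∈ K_{c_j}` and
`c_j ∈ {0, …, k}`; a list entry `(α_j, c_j)` is one summand. -/
def decompositionWeights (P : RootPairing ι ℝ V N) (k : ℕ) (K : ℕ → Set ι) (α : ι) : Set ℕ :=
  {n | ∃ l : List (ι × ℕ), (∀ p ∈ l, p.2 ≤ k ∧ p.1 ∈ K p.2) ∧
    (l.map fun p => P.root p.1).sum = P.root α ∧ (l.map fun p => p.2).sum = n}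

/-- `k_α(J)` for a chain of `k` order filters `J`; the maximum of a nonempty finite set. -/
def filterWeight (P : RootPairing ι ℝ V N) (k : ℕ) (J : ℕ → Set ι) (α : ι) : ℕ :=
  sSup (decompositionWeights P k J α)

/-- `r_α(I)` for a positive chain of `k` ideals `I`; the minimum of a nonempty set. -/
def idealWeight (P : RootPairing ι ℝ V N) (k : ℕ) (I : ℕ → Set ι) (α : ι) : ℕ :=
  sInf (decompositionWeights P k I α)

/-- The minimal alcove of a dominant region `R`: `k_α < ⟨x, α⟩ < k_α + 1` for all positive `α`,
where `k_α = k_α(φ(R))`. -/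
def minimalAlcove {P : RootPairing ι ℝ V N} (b : P.Base) (k : ℕ) (R : Set V) : Set V :=
  {x | ∀ α, b.IsPos α →
    (filterWeight P k (filterChain b R) α : ℝ) < ⟪x, P.root α⟫_ℝ ∧
    ⟪x, P.root α⟫_ℝ < (filterWeight P k (filterChain b R) α : ℝ) + 1}

/-- The chain of `k + 1` ideals that extends `θ(R) = (I_1, …, I_k)` by the ideal consisting of the
positive roots in some `I_i + I_j` with `i + j = k + 1`, the elements of `I_k` and the simple
roots. -/
def extendedIdealChain {P : RootPairing ι ℝ V N} (b : P.Base) (k : ℕ) (R : Set V) (i : ℕ) :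
    Set ι :=
  if i ≤ k then idealChain b R i
  else {α | b.IsPos α ∧ ∃ (p q : ℕ) (β γ : ι), 1 ≤ p ∧ 1 ≤ q ∧ p + q = k + 1 ∧
        β ∈ idealChain b R p ∧ γ ∈ idealChain b R q ∧ P.root α = P.root β + P.root γ}
      ∪ idealChain b R k ∪ (b.support : Set ι)

/-- The pseudomaximal alcove of a dominant region `R`: `r_α - 1 < ⟨x, α⟩ < r_α` for all positive
`α`, where `r_α` is the weight of `α` for the extended chain of `k + 1` ideals. -/
def pseudomaximalAlcove {P : RootPairing ι ℝ V N} (b : P.Base) (k : ℕ) (R : Set V) : Set V :=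
  {x | ∀ α, b.IsPos α →
    (idealWeight P (k + 1) (extendedIdealChain b k R) α : ℝ) - 1 < ⟪x, P.root α⟫_ℝ ∧
    ⟪x, P.root α⟫_ℝ < (idealWeight P (k + 1) (extendedIdealChain b k R) α : ℝ)}

end CatalanArrangement

end

open scoped InnerProductSpace

namespace CatalanArrangement

variable {ι V N : Type*} [NormedAddCommGroup V] [InnerProductSpace ℝ V]
  [AddCommGroup N] [Module ℝ N] {P : RootPairing ι ℝ V N}

/-! An affine root is a function `x ↦ ⟪x, α⟫ - r`. It is simple at a generic point `x` if reflecting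
`x` in it makes no other affine root positive at `x` negative; its hyperplane is then a wall of the
alcove of `x`. The plan is to replace a region by one alcove inside it that has all hyperplanes of
`M` as walls, and to apply Coxeter theory there.

Finding the alcove is a descent, `exists_forall_isIrreducibleAt_mem`: among generic points of the
region take one minimising the sum of the levels `⌊⟪x, α⟫⌋` over positive roots. If a positive root
is irreducible at `x` (its level is not the sum of the levels of two positive summands) but its
affine root is not among the bounding ones, then for a highest such root the affine root is simple,
and reflecting in it lowers the sum without leaving the region. The combinatorial core is
`exists_isIrreducibleAt_add`. At the minimum every level is a sum of levels at most `k`, so the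
levels are the numbers `k_α` and the alcove is `A(R)`. Reversing the positive system, on the part of
the region where simple roots stay below `k + 1`, gives `r_α - 1` and `B(R)`. That floors and
ceilings of the region are walls of these alcoves is `IsFloor.isSimpleAt` and
`IsCeiling.isSimpleAt`.

Now let `M` consist of walls of the alcove of `x`, with gradients in an open half-space. The
gradients are pairwise obtuse, hence independent, so the walls meet and the group `W'` is finite.
Every affine root in the span of `M` is, up to sign, a sum of elements of `M`
(`mem_addSubmonoidClosure_of_mem_span`), and the unique longest element flips at `x` exactly these
affine roots. It therefore carries `x` across all of `M` and keeps `M` as walls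
(`IsLongest.isSimpleAt_negRoot`). It preserves dominance because no nonempty sum from `M` vanishes
at the origin (`IsDominantRegion.sideSet_longest`). Finally, `apply_mem_sideSet_of_mem_sideSet`
shows that the longest element, applied to any generic point of the new region at which the
opposites of `M` are simple, leads back to the old region. Hence the maps defined through `A` and
through `B` are mutually inverse. -/

/-! ### Affine roots -/

/-- The affine root `x ↦ ⟨x, α⟩ - r` attached to the pair `(α, r)`. -/
noncomputable def affineRoot (P : RootPairing ι ℝ V N) (p : ι × ℤ) (x : V) : ℝ :=
  ⟪x, P.root p.1⟫_ℝ - p.2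

/-- The reflection in the zero set of an affine root. -/
noncomputable def wallReflection (P : RootPairing ι ℝ V N) (p : ι × ℤ) : Equiv.Perm V :=
  affineReflection P p.1 p.2

/-- The pair representing the negative of an affine root. -/
def negRoot (P : RootPairing ι ℝ V N) (p : ι × ℤ) : ι × ℤ :=
  (P.reflectionPerm p.1 p.1, -p.2)

/-- The pair representing the composition of the affine root `q` with the reflection in `p`. -/
noncomputable def reflectRoot (P : RootPairing ι ℝ V N) [P.IsCrystallographic] (p q : ι × ℤ) :
    ι × ℤ :=
  (P.reflectionPerm p.1 q.1, q.2 - P.pairingIn ℤ q.1 p.1 * p.2)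

theorem root_negIndex (α : ι) : P.root (P.reflectionPerm α α) = -P.root α := by simp

theorem inner_root_self_pos (α : ι) : 0 < ⟪P.root α, P.root α⟫_ℝ :=
  real_inner_self_pos.mpr (P.ne_zero α)

theorem affineRoot_negRoot (p : ι × ℤ) (x : V) :
    affineRoot P (negRoot P p) x = -affineRoot P p x := by
  simp [affineRoot, negRoot, inner_neg_right]
  ring

theorem wallReflection_apply (p : ι × ℤ) (x : V) :
    wallReflection P p x =
      x - (2 * affineRoot P p x / ⟪P.root p.1, P.root p.1⟫_ℝ) • P.root p.1 := rfl

theorem wallReflection_negRoot (p : ι × ℤ) :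
    wallReflection P (negRoot P p) = wallReflection P p := by
  ext x
  simp only [wallReflection_apply, affineRoot_negRoot]
  simp [negRoot]
  rw [neg_div, neg_smul]
  abel

theorem wallReflection_mul_self (p : ι × ℤ) :
    wallReflection P p * wallReflection P p = 1 := by
  ext x
  exact (affineReflection P p.1 p.2).apply_symm_apply x

theorem wallReflection_inv (p : ι × ℤ) : (wallReflection P p)⁻¹ = wallReflection P p :=
  inv_eq_of_mul_eq_one_right (wallReflection_mul_self p)

theorem wallReflection_wallReflection (p : ι × ℤ) (x : V) :
    wallReflection P p (wallReflection P p x) = x :=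
  Equiv.congr_fun (wallReflection_mul_self p) x

theorem wallReflection_mem_affineWeylGroup (p : ι × ℤ) :
    wallReflection P p ∈ affineWeylGroup P :=
  Subgroup.subset_closure ⟨p.1, p.2, rfl⟩

theorem affineRoot_injective : Function.Injective (affineRoot P) := by
  intro p q h
  have h0 : p.2 = q.2 := by
    have := congrFun h 0
    simpa [affineRoot] using this
  have h1 : P.root p.1 = P.root q.1 := by
    refine ext_inner_left ℝ fun x => ?_
    have := congrFun h x
    simpa [affineRoot, h0] using this
  exact Prod.ext (P.root.injective h1) h0

theorem negRoot_negRoot (p : ι × ℤ) : negRoot P (negRoot P p) = p := by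
  apply affineRoot_injective (P := P)
  ext x
  simp [affineRoot_negRoot]

/-- Since `s_α α = -α`, invariance of the inner product under `s_α`, tested on `β` and `α`,
identifies the abstract pairing with the Euclidean one. -/
theorem pairingIn_mul_inner (hP : IsEuclidean P) [P.IsCrystallographic] (β α : ι) :
    (P.pairingIn ℤ β α : ℝ) * ⟪P.root α, P.root α⟫_ℝ = 2 * ⟪P.root β, P.root α⟫_ℝ := by
  have h := hP α (P.root β) (P.root α)
  have h1 : P.reflection α (P.root β) = P.root β - (P.pairingIn ℤ β α : ℝ) • P.root α := by
    rw [P.reflection_apply_root]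
    congr 2
    exact (P.algebraMap_pairingIn ℤ β α).symm
  rw [P.reflection_apply_self, h1, inner_neg_right, inner_sub_left, real_inner_smul_left] at h
  linarith

theorem pairingIn_pos_iff (hP : IsEuclidean P) [P.IsCrystallographic] {β α : ι} :
    0 < P.pairingIn ℤ β α ↔ 0 < ⟪P.root β, P.root α⟫_ℝ := by
  have h := pairingIn_mul_inner hP β α
  have h0 := inner_root_self_pos (P := P) α
  constructor
  · intro h1
    have : (0 : ℝ) < P.pairingIn ℤ β α := by exact_mod_cast h1
    have := mul_pos this h0
    linarith
  · intro h1
    have : 0 < (P.pairingIn ℤ β α : ℝ) * ⟪P.root α, P.root α⟫_ℝ := by linarith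
    exact_mod_cast (pos_iff_pos_of_mul_pos this).mpr h0

theorem exists_root_eq_sub [Finite ι] (hP : IsEuclidean P) [P.IsCrystallographic] {β α : ι}
    (h : 0 < ⟪P.root β, P.root α⟫_ℝ) (hne : β ≠ α) : ∃ γ, P.root γ = P.root β - P.root α :=
  P.root_sub_root_mem_of_pairingIn_pos ((pairingIn_pos_iff hP).mpr h) hne

theorem affineRoot_wallReflection (hP : IsEuclidean P) [P.IsCrystallographic] (p q : ι × ℤ)
    (x : V) : affineRoot P q (wallReflection P p x) =
      affineRoot P q x - P.pairingIn ℤ q.1 p.1 * affineRoot P p x := by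
  have h := pairingIn_mul_inner hP q.1 p.1
  have h0 := inner_root_self_pos (P := P) p.1
  have h2 : (P.pairingIn ℤ q.1 p.1 : ℝ) =
      2 * ⟪P.root q.1, P.root p.1⟫_ℝ / ⟪P.root p.1, P.root p.1⟫_ℝ := by
    field_simp; linarith
  rw [wallReflection_apply, h2]
  simp only [affineRoot, inner_sub_left, real_inner_smul_left]
  rw [real_inner_comm (P.root q.1) (P.root p.1)]
  ring

theorem affineRoot_reflectRoot (hP : IsEuclidean P) [P.IsCrystallographic] (p q : ι × ℤ) (x : V) :
    affineRoot P (reflectRoot P p q) x = affineRoot P q (wallReflection P p x) := by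
  rw [affineRoot_wallReflection hP]
  have h1 : P.root (P.reflectionPerm p.1 q.1) =
      P.root q.1 - (P.pairingIn ℤ q.1 p.1 : ℝ) • P.root p.1 := by
    rw [P.root_reflectionPerm, P.reflection_apply_root]
    congr 2
    exact (P.algebraMap_pairingIn ℤ q.1 p.1).symm
  simp only [affineRoot, reflectRoot, h1, inner_sub_right, real_inner_smul_right]
  push_cast
  ring

theorem affineRoot_wallReflection_self (hP : IsEuclidean P) [P.IsCrystallographic] (p : ι × ℤ)
    (x : V) : affineRoot P p (wallReflection P p x) = -affineRoot P p x := by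
  have h : (P.pairingIn ℤ p.1 p.1 : ℝ) = 2 := by simp
  rw [affineRoot_wallReflection hP, h]
  ring

theorem wallReflection_conj_wallReflection (hP : IsEuclidean P) [P.IsCrystallographic]
    (p q : ι × ℤ) :
    wallReflection P p * wallReflection P q * (wallReflection P p)⁻¹ =
      wallReflection P (reflectRoot P p q) := by
  rw [wallReflection_inv]
  ext x
  have h1 : P.root (P.reflectionPerm p.1 q.1) =
      P.root q.1 - (P.pairingIn ℤ q.1 p.1 : ℝ) • P.root p.1 := by
    rw [P.root_reflectionPerm, P.reflection_apply_root]
    congr 2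
    exact (P.algebraMap_pairingIn ℤ q.1 p.1).symm
  have h2 : ⟪P.root (P.reflectionPerm p.1 q.1), P.root (P.reflectionPerm p.1 q.1)⟫_ℝ =
      ⟪P.root q.1, P.root q.1⟫_ℝ := by
    rw [P.root_reflectionPerm]; exact hP _ _ _
  -- An affine reflection moves differences of points by its linear part.
  have lin : ∀ (y : V) (c : ℝ), wallReflection P p (y - c • P.root q.1) =
      wallReflection P p y - c • P.root (P.reflectionPerm p.1 q.1) := by
    intro y c
    have h := pairingIn_mul_inner hP q.1 p.1
    have h0 := inner_root_self_pos (P := P) p.1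
    have h2 : (P.pairingIn ℤ q.1 p.1 : ℝ) =
        2 * ⟪P.root q.1, P.root p.1⟫_ℝ / ⟪P.root p.1, P.root p.1⟫_ℝ := by
      field_simp; linarith
    rw [h1, wallReflection_apply, wallReflection_apply, h2]
    simp only [affineRoot, inner_sub_left, real_inner_smul_left]
    module
  rw [Equiv.Perm.mul_apply, Equiv.Perm.mul_apply, wallReflection_apply q, lin,
    wallReflection_wallReflection, wallReflection_apply (reflectRoot P p q),
    affineRoot_reflectRoot hP]
  simp only [reflectRoot, h2]

/-- The affine Weyl group permutes the affine roots, compatibly with the reflections. -/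
theorem exists_affineRoot_conj (hP : IsEuclidean P) [P.IsCrystallographic] {u : Equiv.Perm V}
    (hu : u ∈ affineWeylGroup P) (p : ι × ℤ) :
    ∃ q, (∀ x, affineRoot P q (u x) = affineRoot P p x) ∧
      u * wallReflection P p * u⁻¹ = wallReflection P q := by
  -- Treating `u` and `u⁻¹` together makes the inverse case of the closure induction a swap.
  suffices h : ∀ p, (∃ q, (∀ x, affineRoot P q (u x) = affineRoot P p x) ∧
      u * wallReflection P p * u⁻¹ = wallReflection P q) ∧
      ∃ q, (∀ x, affineRoot P q (u⁻¹ x) = affineRoot P p x) ∧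
      u⁻¹ * wallReflection P p * u = wallReflection P q from (h p).1
  clear p
  induction hu using Subgroup.closure_induction with
  | mem s hs =>
    obtain ⟨α, r, rfl⟩ := hs
    intro p
    change (∃ q, (∀ x, affineRoot P q (wallReflection P (α, r) x) = affineRoot P p x) ∧
      wallReflection P (α, r) * wallReflection P p * (wallReflection P (α, r))⁻¹ =
        wallReflection P q) ∧
      ∃ q, (∀ x, affineRoot P q ((wallReflection P (α, r))⁻¹ x) = affineRoot P p x) ∧
      (wallReflection P (α, r))⁻¹ * wallReflection P p * wallReflection P (α, r) =
        wallReflection P q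
    have h1 := wallReflection_conj_wallReflection hP (α, r) p
    have h2 : ∀ x, affineRoot P (reflectRoot P (α, r) p) (wallReflection P (α, r) x) =
        affineRoot P p x := fun x => by
      rw [affineRoot_reflectRoot hP, wallReflection_wallReflection]
    rw [wallReflection_inv] at h1 ⊢
    exact ⟨⟨_, h2, h1⟩, ⟨_, h2, h1⟩⟩
  | one => exact fun p => ⟨⟨p, fun x => rfl, by simp⟩, ⟨p, fun x => by simp, by simp⟩⟩
  | mul u v _ _ hu hv =>
    intro p
    constructor
    · obtain ⟨q, hq, hq'⟩ := (hv p).1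
      obtain ⟨q', h, h'⟩ := (hu q).1
      refine ⟨q', fun x => by rw [Equiv.Perm.mul_apply, h, hq], ?_⟩
      rw [← h', ← hq']
      group
    · obtain ⟨q, hq, hq'⟩ := (hu p).2
      obtain ⟨q', h, h'⟩ := (hv q).2
      refine ⟨q', fun x => by rw [mul_inv_rev, Equiv.Perm.mul_apply, h, hq], ?_⟩
      rw [← h', ← hq']
      group
  | inv u _ hu =>
    intro p
    rw [inv_inv]
    exact ⟨(hu p).2, (hu p).1⟩

/-! ### Generic points -/

theorem affineRoot_ne_zero {x : V} (hx : x ∉ affineArrangement P) (p : ι × ℤ) :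
    affineRoot P p x ≠ 0 := by
  intro h
  exact hx ⟨p.1, p.2, sub_eq_zero.mp h⟩

theorem notMem_affineArrangement_iff {x : V} :
    x ∉ affineArrangement P ↔ ∀ p, affineRoot P p x ≠ 0 := by
  refine ⟨affineRoot_ne_zero, fun h ⟨α, r, hx⟩ => h (α, r) ?_⟩
  exact sub_eq_zero.mpr hx

theorem affineRoot_pos_of_not_neg {x : V} (hx : x ∉ affineArrangement P) {p : ι × ℤ}
    (h : ¬ affineRoot P p x < 0) : 0 < affineRoot P p x :=
  lt_of_le_of_ne (not_lt.mp h) (affineRoot_ne_zero hx p).symm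

theorem affineRoot_neg_of_not_pos {x : V} (hx : x ∉ affineArrangement P) {p : ι × ℤ}
    (h : ¬ 0 < affineRoot P p x) : affineRoot P p x < 0 :=
  lt_of_le_of_ne (not_lt.mp h) (affineRoot_ne_zero hx p)

theorem apply_notMem_affineArrangement (hP : IsEuclidean P) [P.IsCrystallographic]
    {u : Equiv.Perm V} (hu : u ∈ affineWeylGroup P) {x : V} (hx : x ∉ affineArrangement P) :
    u x ∉ affineArrangement P := by
  rw [notMem_affineArrangement_iff]
  intro p
  obtain ⟨q, hq, -⟩ := exists_affineRoot_conj hP (inv_mem hu) p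
  rw [← hq, ← Equiv.Perm.mul_apply, inv_mul_cancel]
  exact affineRoot_ne_zero hx q

/-- The integer part of `⟨x, α⟩`. -/
noncomputable def level (P : RootPairing ι ℝ V N) (x : V) (α : ι) : ℤ := ⌊⟪x, P.root α⟫_ℝ⌋

theorem le_level_iff {x : V} (hx : x ∉ affineArrangement P) {α : ι} {r : ℤ} :
    r ≤ level P x α ↔ 0 < affineRoot P (α, r) x := by
  rw [level, Int.le_floor]
  refine ⟨fun h => affineRoot_pos_of_not_neg hx ?_, fun h => ?_⟩
  · simpa [affineRoot] using h
  · exact (sub_pos.mp h).le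

theorem affineRoot_level_pos {x : V} (hx : x ∉ affineArrangement P) (α : ι) :
    0 < affineRoot P (α, level P x α) x := (le_level_iff hx).mp le_rfl

theorem affineRoot_level_lt_one (x : V) (α : ι) :
    affineRoot P (α, level P x α) x < 1 := by
  have := Int.lt_floor_add_one ⟪x, P.root α⟫_ℝ
  simp only [affineRoot, level]
  linarith

theorem level_neg {x : V} (hx : x ∉ affineArrangement P) (α : ι) :
    level P x (P.reflectionPerm α α) = -level P x α - 1 := by
  have h := affineRoot_level_pos hx α
  have h' := affineRoot_level_lt_one (P := P) x α
  simp only [affineRoot] at h h'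
  rw [level, Int.floor_eq_iff, root_negIndex, inner_neg_right]
  push_cast
  constructor <;> linarith

theorem level_add_le {x : V} {α β γ : ι} (h : P.root α = P.root β + P.root γ) :
    level P x β + level P x γ ≤ level P x α := by
  rw [level, level, level, h, inner_add_right]
  exact Int.le_floor_add _ _

theorem level_le_add {x : V} {α β γ : ι} (h : P.root α = P.root β + P.root γ) :
    level P x α ≤ level P x β + level P x γ + 1 := by
  have := Int.le_floor_add_floor ⟪x, P.root β⟫_ℝ ⟪x, P.root γ⟫_ℝ
  rw [level, level, level, h, inner_add_right]
  omega

/-! ### Simple affine roots at a generic point -/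

/-- The affine root `p` is simple at `x`: it is positive at `x`, and no other affine root that is
positive at `x` becomes negative when `x` is reflected in `p`. -/
def IsSimpleAt (P : RootPairing ι ℝ V N) (x : V) (p : ι × ℤ) : Prop :=
  0 < affineRoot P p x ∧
    ∀ q, 0 < affineRoot P q x → affineRoot P q (wallReflection P p x) < 0 → q = p

theorem affineRoot_add {α β γ : ι} {r s t : ℤ} (h : P.root α = P.root β + P.root γ)
    (h' : r = s + t) (x : V) :
    affineRoot P (α, r) x = affineRoot P (β, s) x + affineRoot P (γ, t) x := by
  simp only [affineRoot, h, h', inner_add_right]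
  push_cast
  ring

theorem root_eq_and_eq_of_affineRoot_eq_add {p q r : ι × ℤ}
    (h : ∀ y, affineRoot P p y = affineRoot P q y + affineRoot P r y) :
    P.root p.1 = P.root q.1 + P.root r.1 ∧ p.2 = q.2 + r.2 := by
  have h0 : (p.2 : ℝ) = q.2 + r.2 := by
    have := h 0
    simp only [affineRoot, inner_zero_left] at this
    linarith
  refine ⟨ext_inner_left ℝ fun y => ?_, by exact_mod_cast h0⟩
  have := h y
  simp only [affineRoot] at this
  rw [inner_add_right]
  linarith

/-- Positivity bounds each offset by the level of its root, and levels are superadditive, so all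
these inequalities are equalities. -/
theorem level_eq_of_decomposition {x : V} (hx : x ∉ affineArrangement P)
    {α : ι} {β γ : ι × ℤ}
    (h : ∀ y, affineRoot P (α, level P x α) y = affineRoot P β y + affineRoot P γ y)
    (hβ : 0 < affineRoot P β x) (hγ : 0 < affineRoot P γ x) :
    P.root α = P.root β.1 + P.root γ.1 ∧ level P x α = level P x β.1 + level P x γ.1 := by
  obtain ⟨h, h'⟩ := root_eq_and_eq_of_affineRoot_eq_add h
  have h1 := (le_level_iff hx).mpr hβ
  have h2 := (le_level_iff hx).mpr hγ
  have := level_add_le (x := x) h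
  refine ⟨h, ?_⟩
  simp only at h h' this
  omega

/-- An affine root that is not a sum of two affine roots positive at `x` is simple at `x`. -/
theorem isSimpleAt_of_indecomposable [Finite ι] (hP : IsEuclidean P) [P.IsCrystallographic]
    [P.IsReduced] {x : V} (hx : x ∉ affineArrangement P) {α : ι}
    (h : ∀ β γ, P.root α = P.root β + P.root γ → level P x α ≠ level P x β + level P x γ) :
    IsSimpleAt P x (α, level P x α) := by
  set g : ι × ℤ := (α, level P x α) with hg
  have hg1 := affineRoot_level_pos hx α
  refine ⟨hg1, ?_⟩
  -- Induction on a bound for the pairing of `q` with `α`. If the pairing is nonpositive, the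
  -- reflection in `g` cannot decrease `q` at `x`, so `q` does not change sign.
  have key : ∀ (n : ℕ) (q : ι × ℤ), P.pairingIn ℤ q.1 α ≤ n → 0 < affineRoot P q x →
      affineRoot P q (wallReflection P g x) < 0 → q = g := by
    intro n
    induction n with
    | zero =>
      intro q hn hq hq'
      rw [affineRoot_wallReflection hP] at hq'
      have : (P.pairingIn ℤ q.1 α : ℝ) ≤ 0 := by exact_mod_cast hn
      nlinarith
    | succ n ih =>
      intro q hn hq hq'
      by_cases hqα : q.1 = α
      · have h2 : (P.pairingIn ℤ q.1 α : ℝ) = 2 := by rw [hqα]; simp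
        have h1 := (le_level_iff hx).mpr hq
        rw [affineRoot_wallReflection hP, h2] at hq'
        have h3 := affineRoot_level_lt_one (P := P) x α
        have : (level P x α : ℝ) < q.2 + 1 := by
          simp only [hg, affineRoot, hqα] at hq' h3
          linarith
        have : level P x α < q.2 + 1 := by exact_mod_cast this
        rw [hqα] at h1
        exact Prod.ext hqα (by simp only [hg]; omega)
      · have hpos : 0 < P.pairingIn ℤ q.1 α := by
          by_contra hcon
          rw [affineRoot_wallReflection hP] at hq'
          have : (P.pairingIn ℤ q.1 α : ℝ) ≤ 0 := by exact_mod_cast not_lt.mp hcon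
          nlinarith
        obtain ⟨γ, hγ⟩ := P.root_sub_root_mem_of_pairingIn_pos hpos hqα
        set f : ι × ℤ := (γ, q.2 - level P x α) with hf
        have hfx : ∀ y, affineRoot P f y = affineRoot P q y - affineRoot P g y := by
          intro y
          simp only [affineRoot, hf, hg, hγ, inner_sub_right]
          push_cast
          ring
        -- Here `f = q - g`. If `f` is negative at `x`, then `g = q + (-f)` is a forbidden
        -- decomposition.
        rcases lt_or_gt_of_ne (affineRoot_ne_zero hx f) with hneg | hfpos
        · exfalso
          obtain ⟨e1, e2⟩ := level_eq_of_decomposition hx (α := α) (β := q) (γ := negRoot P f)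
            (fun y => by rw [affineRoot_negRoot, hfx]; ring) hq
            (by rw [affineRoot_negRoot]; linarith)
          exact h _ _ e1 e2
        · by_cases hs : affineRoot P f (wallReflection P g x) < 0
          · have : f = g := by
              refine ih f ?_ hfpos hs
              have hp : (P.pairingIn ℤ γ α : ℝ) ≤ n := by
                have e1 := pairingIn_mul_inner hP γ α
                have e2 := pairingIn_mul_inner hP q.1 α
                have e0 := inner_root_self_pos (P := P) α
                rw [hγ, inner_sub_left] at e1
                have hn' : (P.pairingIn ℤ q.1 α : ℝ) ≤ n + 1 := by exact_mod_cast hn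
                have : (P.pairingIn ℤ γ α : ℝ) = P.pairingIn ℤ q.1 α - 2 := by
                  apply mul_right_cancel₀ e0.ne'
                  linarith
                linarith
              exact_mod_cast hp
            exfalso
            have h3 : γ = α := congrArg Prod.fst this
            rw [h3] at hγ
            have : IsAddTorsionFree V := .of_isTorsionFree ℝ V
            refine P.nsmul_notMem_range_root (n := 2) (i := α) ⟨q.1, ?_⟩
            rw [two_smul]
            exact (eq_sub_iff_add_eq.mp hγ).symm
          · exfalso
            have hs' := affineRoot_pos_of_not_neg
              (apply_notMem_affineArrangement hP (wallReflection_mem_affineWeylGroup g) hx) hs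
            rw [← affineRoot_reflectRoot hP] at hs' hq'
            -- As `s_g g = -g`, reflecting `f = q - g` gives `g = s_g f + (-s_g q)`, with both
            -- summands positive at `x`.
            have hsum : ∀ y, affineRoot P g y = affineRoot P (reflectRoot P g f) y +
                affineRoot P (negRoot P (reflectRoot P g q)) y := by
              intro y
              rw [affineRoot_negRoot, affineRoot_reflectRoot hP, affineRoot_reflectRoot hP, hfx,
                affineRoot_wallReflection_self hP]
              ring
            obtain ⟨e1, e2⟩ := level_eq_of_decomposition hx hsum hs'
              (by rw [affineRoot_negRoot]; linarith)
            exact h _ _ e1 e2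
  exact fun q => key (P.pairingIn ℤ q.1 α).toNat q (Int.self_le_toNat _)

/-- The affine root with gradient `p.1` and offset the level is positive at `x` and lies below `p`
everywhere, so the reflection in `p` makes it negative too; simplicity identifies the two. -/
theorem IsSimpleAt.eq_level (hP : IsEuclidean P) [P.IsCrystallographic] {x : V}
    (hx : x ∉ affineArrangement P) {p : ι × ℤ} (hp : IsSimpleAt P x p) : p.2 = level P x p.1 := by
  have h1 := (le_level_iff hx).mpr hp.1
  have h2 : affineRoot P (p.1, level P x p.1) (wallReflection P p x) < 0 := by
    have h3 := affineRoot_wallReflection_self hP p x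
    have h4 := hp.1
    have h5 : (p.2 : ℝ) ≤ level P x p.1 := by exact_mod_cast h1
    simp only [affineRoot] at h3 h4 ⊢
    linarith
  exact (congrArg Prod.snd (hp.2 _ (affineRoot_level_pos hx _) h2)).symm

/-- Otherwise `p - q` is an affine root; up to exchanging `p` and `q` it is positive at `x`.
Reflection in `p` turns it negative, since `q` stays positive, and simplicity of `p` would force the
gradient of `q` to vanish. -/
theorem IsSimpleAt.inner_nonpos [Finite ι] (hP : IsEuclidean P) [P.IsCrystallographic] {x : V}
    (hx : x ∉ affineArrangement P) {p q : ι × ℤ} (hp : IsSimpleAt P x p) (hq : IsSimpleAt P x q)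
    (hpq : p ≠ q) : ⟪P.root p.1, P.root q.1⟫_ℝ ≤ 0 := by
  by_contra! hcon
  have hne : p.1 ≠ q.1 := fun h => hpq (Prod.ext h (by
    rw [hp.eq_level hP hx, hq.eq_level hP hx, h]))
  have aux : ∀ {p q : ι × ℤ} {γ : ι}, IsSimpleAt P x p → IsSimpleAt P x q → p ≠ q →
      P.root γ = P.root p.1 - P.root q.1 → ¬ 0 < affineRoot P (γ, p.2 - q.2) x := by
    intro p q γ hp hq hpq hγ h
    have e : ∀ y, affineRoot P (γ, p.2 - q.2) y = affineRoot P p y - affineRoot P q y := by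
      intro y
      simp only [affineRoot, hγ, inner_sub_right]
      push_cast
      ring
    have h1 : affineRoot P (γ, p.2 - q.2) (wallReflection P p x) < 0 := by
      rw [e, affineRoot_wallReflection_self hP]
      have := not_lt.mp fun h => hpq.symm (hp.2 _ hq.1 h)
      linarith [hp.1]
    have h2 := hp.2 _ h h1
    have h3 : γ = p.1 := congrArg Prod.fst h2
    rw [h3, eq_comm, sub_eq_self] at hγ
    exact P.ne_zero q.1 hγ
  obtain ⟨γ, hγ⟩ := exists_root_eq_sub hP hcon hne
  rw [real_inner_comm] at hcon
  obtain ⟨δ, hδ⟩ := exists_root_eq_sub hP hcon hne.symm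
  have h1 := aux hp hq hpq hγ
  have h2 := aux hq hp hpq.symm hδ
  have e : affineRoot P (δ, q.2 - p.2) x = -affineRoot P (γ, p.2 - q.2) x := by
    simp only [affineRoot, hγ, hδ, inner_sub_right]
    push_cast
    ring
  rcases lt_or_gt_of_ne (affineRoot_ne_zero hx (γ, p.2 - q.2)) with h | h
  · exact h2 (by linarith)
  · exact h1 h

/-! ### Words in the reflections -/

theorem wordLength_le_length {G : Type*} [Group G] {S : Set G} {l : List G}
    (hl : ∀ s ∈ l, s ∈ S) : wordLength S l.prod ≤ l.length :=
  Nat.sInf_le ⟨l, hl, rfl, rfl⟩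

theorem wordLength_map_le (M : Set (ι × ℤ)) {l : List (ι × ℤ)} (hl : ∀ p ∈ l, p ∈ M) :
    wordLength (wallReflection P '' M) (l.map (wallReflection P)).prod ≤ l.length := by
  have := wordLength_le_length (S := wallReflection P '' M) (l := l.map (wallReflection P)) (by
    intro s hs
    obtain ⟨p, hp, rfl⟩ := List.mem_map.mp hs
    exact ⟨p, hl p hp, rfl⟩)
  simpa using this

theorem closure_le_affineWeylGroup (M : Set (ι × ℤ)) :
    Subgroup.closure (wallReflection P '' M) ≤ affineWeylGroup P := by
  rw [Subgroup.closure_le]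
  rintro _ ⟨p, -, rfl⟩
  exact wallReflection_mem_affineWeylGroup p

theorem exists_list_of_forall_mem_image {M : Set (ι × ℤ)} {l : List (Equiv.Perm V)}
    (hl : ∀ s ∈ l, s ∈ wallReflection P '' M) :
    ∃ l' : List (ι × ℤ), (∀ p ∈ l', p ∈ M) ∧ l'.map (wallReflection P) = l := by
  induction l with
  | nil => exact ⟨[], by simp, rfl⟩
  | cons s l ih =>
    obtain ⟨l', h1, rfl⟩ := ih fun s hs => hl s (List.mem_cons_of_mem _ hs)
    obtain ⟨p, hp, rfl⟩ := hl s List.mem_cons_self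
    exact ⟨p :: l', by simpa [hp] using h1, rfl⟩

theorem exists_reduced_word {M : Set (ι × ℤ)} {w : Equiv.Perm V}
    (hw : w ∈ Subgroup.closure (wallReflection P '' M)) :
    ∃ l : List (ι × ℤ), (∀ p ∈ l, p ∈ M) ∧ (l.map (wallReflection P)).prod = w ∧
      l.length = wordLength (wallReflection P '' M) w := by
  have hne : {n | ∃ l : List (Equiv.Perm V), (∀ s ∈ l, s ∈ wallReflection P '' M) ∧
      l.prod = w ∧ l.length = n}.Nonempty := by
    suffices h : ∃ l : List (Equiv.Perm V), (∀ s ∈ l, s ∈ wallReflection P '' M) ∧ l.prod = w by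
      obtain ⟨l, hl, hw⟩ := h
      exact ⟨_, l, hl, hw, rfl⟩
    induction hw using Subgroup.closure_induction with
    | mem s hs => exact ⟨[s], by simpa using hs, by simp⟩
    | one => exact ⟨[], by simp, rfl⟩
    | mul u v _ _ hu hv =>
      obtain ⟨l, hl, rfl⟩ := hu
      obtain ⟨l', hl', rfl⟩ := hv
      refine ⟨l ++ l', fun s hs => ?_, List.prod_append⟩
      rcases List.mem_append.mp hs with h | h
      exacts [hl s h, hl' s h]
    | inv u _ hu =>
      obtain ⟨l, hl, rfl⟩ := hu
      refine ⟨(l.map fun s => s⁻¹).reverse, fun s hs => ?_, (List.prod_inv_reverse l).symm⟩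
      obtain ⟨t, ht, rfl⟩ := List.mem_map.mp (List.mem_reverse.mp hs)
      obtain ⟨p, hp, rfl⟩ := hl t ht
      exact ⟨p, hp, (wallReflection_inv p).symm⟩
  obtain ⟨l, hl, hlw, hn⟩ := Nat.sInf_mem hne
  obtain ⟨l', h1, rfl⟩ := exists_list_of_forall_mem_image hl
  rw [List.length_map] at hn
  exact ⟨l', h1, hlw, hn⟩

theorem prod_map_mem_closure {M : Set (ι × ℤ)} {l : List (ι × ℤ)} (hl : ∀ p ∈ l, p ∈ M) :
    (l.map (wallReflection P)).prod ∈ Subgroup.closure (wallReflection P '' M) := by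
  refine Subgroup.list_prod_mem _ fun s hs => ?_
  obtain ⟨p, hp, rfl⟩ := List.mem_map.mp hs
  exact Subgroup.subset_closure ⟨p, hl p hp, rfl⟩

/-! ### Spans of affine roots -/

theorem linearIndependent_of_inner_nonpos {κ : Type*} (z : V) (v : κ → V)
    (hp : ∀ i, 0 < ⟪z, v i⟫_ℝ) (hn : Pairwise fun i j => ⟪v i, v j⟫_ℝ ≤ 0) :
    LinearIndependent ℝ v :=
  LinearMap.BilinForm.linearIndependent_of_pairwise_le_zero (innerₗ V)
    (fun x hx => by simpa using real_inner_self_pos.mpr hx) (innerₗ V z) v hp hn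

theorem exists_forall_inner_eq [FiniteDimensional ℝ V] {κ : Type*} {v : κ → V}
    (hv : LinearIndependent ℝ v) (c : κ → ℝ) : ∃ z : V, ∀ i, ⟪z, v i⟫_ℝ = c i := by
  have := FiniteDimensional.complete ℝ V
  obtain ⟨f, hf⟩ := LinearMap.exists_extend ((Module.Basis.span hv).constr ℝ c)
  refine ⟨(InnerProductSpace.toDual ℝ V).symm (LinearMap.toContinuousLinearMap f), fun i => ?_⟩
  rw [InnerProductSpace.toDual_symm_apply]
  have h := LinearMap.congr_fun hf (Module.Basis.span hv i)
  rw [Module.Basis.constr_basis] at h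
  simpa [Module.Basis.span_apply] using h

theorem eq_zero_of_mem_span {M : Set (ι × ℤ)} {z : V} (hz : ∀ p ∈ M, affineRoot P p z = 0) {f : V → ℝ}
    (hf : f ∈ Submodule.span ℝ (affineRoot P '' M)) : f z = 0 := by
  have : Submodule.span ℝ (affineRoot P '' M) ≤ LinearMap.ker (LinearMap.proj (R := ℝ) z) := by
    rw [Submodule.span_le]
    rintro _ ⟨p, hp, rfl⟩
    exact hz p hp
  exact this hf

/-- Taking gradients is linear; the gradient of `f` is recovered from `f y - f 0`. -/
theorem mem_span_root_of_mem_span {M : Set (ι × ℤ)} {q : ι × ℤ}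
    (hq : affineRoot P q ∈ Submodule.span ℝ (affineRoot P '' M)) :
    P.root q.1 ∈ Submodule.span ℝ ((fun p : ι × ℤ => P.root p.1) '' M) := by
  suffices h : ∀ f ∈ Submodule.span ℝ (affineRoot P '' M),
      ∃ u ∈ Submodule.span ℝ ((fun p : ι × ℤ => P.root p.1) '' M), ∀ y, f y - f 0 = ⟪y, u⟫_ℝ by
    obtain ⟨u, hu, h'⟩ := h _ hq
    convert hu
    refine ext_inner_left ℝ fun y => ?_
    rw [← h' y]
    simp [affineRoot]
  intro f hf
  induction hf using Submodule.span_induction with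
  | mem f hf =>
    obtain ⟨p, hp, rfl⟩ := hf
    exact ⟨_, Submodule.subset_span ⟨p, hp, rfl⟩, fun y => by simp [affineRoot]⟩
  | zero => exact ⟨0, zero_mem _, by simp⟩
  | add f g _ _ hf hg =>
    obtain ⟨u, hu, h⟩ := hf
    obtain ⟨u', hu', h'⟩ := hg
    refine ⟨u + u', add_mem hu hu', fun y => ?_⟩
    rw [inner_add_right, ← h, ← h', Pi.add_apply, Pi.add_apply]
    ring
  | smul c f _ hf =>
    obtain ⟨u, hu, h⟩ := hf
    refine ⟨c • u, Submodule.smul_mem _ _ hu, fun y => ?_⟩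
    rw [real_inner_smul_right, ← h, Pi.smul_apply, Pi.smul_apply, smul_eq_mul, smul_eq_mul]
    ring

theorem nonneg_of_mem_addSubmonoidClosure {M : Set (ι × ℤ)} {y : V} (hy : ∀ p ∈ M, 0 < affineRoot P p y)
    {f : V → ℝ} (hf : f ∈ AddSubmonoid.closure (affineRoot P '' M)) : 0 ≤ f y := by
  induction hf using AddSubmonoid.closure_induction with
  | mem f hf => obtain ⟨p, hp, rfl⟩ := hf; exact (hy p hp).le
  | zero => exact le_rfl
  | add f g _ _ hf hg => exact add_nonneg hf hg

theorem nonpos_of_mem_addSubmonoidClosure {M : Set (ι × ℤ)} {y : V} (hy : ∀ p ∈ M, affineRoot P p y < 0)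
    {f : V → ℝ} (hf : f ∈ AddSubmonoid.closure (affineRoot P '' M)) : f y ≤ 0 := by
  induction hf using AddSubmonoid.closure_induction with
  | mem f hf => obtain ⟨p, hp, rfl⟩ := hf; exact (hy p hp).le
  | zero => exact le_rfl
  | add f g _ _ hf hg => exact add_nonpos hf hg

/-! ### Word length and sign changes in the group generated by simple reflections -/

section Parabolic

variable [P.IsCrystallographic] {x : V} {M : Set (ι × ℤ)}

/-- An affine root separating `x` from `w x` is crossed by the gallery attached to any word for
`w`. -/
theorem exists_crossing (hP : IsEuclidean P) (hx : x ∉ affineArrangement P)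
    (hM : ∀ p ∈ M, IsSimpleAt P x p) {l : List (ι × ℤ)} (hl : ∀ p ∈ l, p ∈ M) {q : ι × ℤ}
    (hq : 0 < affineRoot P q x) (hq' : affineRoot P q ((l.map (wallReflection P)).prod x) < 0) :
    ∃ l₁ p l₂, l = l₁ ++ p :: l₂ ∧
      ∀ y, affineRoot P q ((l₁.map (wallReflection P)).prod y) = affineRoot P p y := by
  induction l generalizing q with
  | nil => exact absurd hq (by simpa using hq'.le)
  | cons p l ih =>
    -- Either the first letter already flips `q`, and then `q` is that letter's root, or `q` is
    -- pulled back through the letter and the rest of the word must cross it.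
    by_cases hp : affineRoot P q (wallReflection P p x) < 0
    · obtain rfl := (hM p (hl p List.mem_cons_self)).2 q hq hp
      exact ⟨[], q, l, rfl, fun y => rfl⟩
    · rw [← affineRoot_reflectRoot hP] at hp
      rw [List.map_cons, List.prod_cons, Equiv.Perm.mul_apply, ← affineRoot_reflectRoot hP] at hq'
      obtain ⟨l₁, p', l₂, rfl, h⟩ := ih (fun p hp => hl p (List.mem_cons_of_mem _ hp))
        (affineRoot_pos_of_not_neg hx hp) hq'
      refine ⟨p :: l₁, p', l₂, rfl, fun y => ?_⟩
      rw [List.map_cons, List.prod_cons, Equiv.Perm.mul_apply, ← affineRoot_reflectRoot hP, h]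

/-- Strong exchange: a reduced word for `w` crosses `q`, so it reads `u s_p u'` with `s_q = u s_p
u⁻¹`. Then `s_q w = u u'` with one letter deleted. -/
theorem wordLength_wallReflection_mul_lt (hP : IsEuclidean P) (hx : x ∉ affineArrangement P)
    (hM : ∀ p ∈ M, IsSimpleAt P x p) {w : Equiv.Perm V}
    (hw : w ∈ Subgroup.closure (wallReflection P '' M)) {q : ι × ℤ}
    (hq : 0 < affineRoot P q x) (hq' : affineRoot P q (w x) < 0) :
    wordLength (wallReflection P '' M) (wallReflection P q * w) <
      wordLength (wallReflection P '' M) w := by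
  obtain ⟨l, hl, rfl, hn⟩ := exists_reduced_word hw
  obtain ⟨l₁, p, l₂, rfl, h⟩ := exists_crossing hP hx hM hl hq hq'
  have h1 : ∀ p ∈ l₁, p ∈ M := fun p hp => hl p (by simp [hp])
  obtain ⟨q', e1, e2⟩ := exists_affineRoot_conj hP
    (closure_le_affineWeylGroup M (prod_map_mem_closure (P := P) h1)) p
  have hqq : q' = q := by
    apply affineRoot_injective (P := P)
    ext y
    obtain ⟨z, rfl⟩ := (l₁.map (wallReflection P)).prod.surjective y
    rw [e1, h]
  rw [hqq] at e2
  have h2 : wallReflection P q * ((l₁ ++ p :: l₂).map (wallReflection P)).prod =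
      ((l₁ ++ l₂).map (wallReflection P)).prod := by
    rw [← e2]
    simp only [List.map_append, List.map_cons, List.prod_append, List.prod_cons]
    rw [mul_assoc, inv_mul_cancel_left, mul_assoc, ← mul_assoc (wallReflection P p),
      wallReflection_mul_self, one_mul]
  rw [h2, ← hn]
  refine (wordLength_map_le M ?_).trans_lt (by simp)
  intro p hp
  apply hl
  simp only [List.mem_append, List.mem_cons] at hp ⊢
  tauto

/-- The group generated by reflections in simple affine roots at `x` acts freely. -/
theorem eq_one_of_forall_pos (hP : IsEuclidean P) (hx : x ∉ affineArrangement P)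
    (hM : ∀ p ∈ M, IsSimpleAt P x p) {w : Equiv.Perm V}
    (hw : w ∈ Subgroup.closure (wallReflection P '' M)) (h : ∀ p ∈ M, 0 < affineRoot P p (w x)) :
    w = 1 := by
  obtain ⟨l, hl, rfl, hn⟩ := exists_reduced_word hw
  cases l with
  | nil => rfl
  | cons p l =>
    exfalso
    have hl' : ∀ p ∈ l, p ∈ M := fun p hp => hl p (List.mem_cons_of_mem _ hp)
    have hp := hl p List.mem_cons_self
    have h1 := h p hp
    rw [List.map_cons, List.prod_cons, Equiv.Perm.mul_apply,
      affineRoot_wallReflection_self hP] at h1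
    -- The first letter's root is negative at the image of `x` under the tail, so prefixing that
    -- letter shortens the tail, contrary to reducedness.
    have h2 := wordLength_wallReflection_mul_lt hP hx hM (prod_map_mem_closure (P := P) hl')
      (hM p hp).1 (by linarith)
    have h3 := wordLength_map_le (P := P) M hl'
    rw [← List.prod_cons, ← List.map_cons, ← hn, List.length_cons] at h2
    omega

/-! ### Roots of the parabolic subgroup -/

/-- Each letter `s_p` changes an affine root by a multiple of `p`, and the changes telescope along a
word. Hence the group preserves the span of `M`. -/
theorem affineRoot_comp_sub_mem_span (hP : IsEuclidean P) {w : Equiv.Perm V}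
    (hw : w ∈ Subgroup.closure (wallReflection P '' M)) (q : ι × ℤ) :
    (fun y => affineRoot P q (w y) - affineRoot P q y) ∈
      Submodule.span ℝ (affineRoot P '' M) := by
  obtain ⟨l, hl, rfl, -⟩ := exists_reduced_word hw
  clear hw
  induction l generalizing q with
  | nil =>
    simp only [List.map_nil, List.prod_nil, Equiv.Perm.one_apply, sub_self]
    exact zero_mem _
  | cons p l ih =>
    have h1 := ih (reflectRoot P p q) (fun p hp => hl p (List.mem_cons_of_mem _ hp))
    have h2 : (P.pairingIn ℤ q.1 p.1 : ℝ) • affineRoot P p ∈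
        Submodule.span ℝ (affineRoot P '' M) :=
      Submodule.smul_mem _ _ (Submodule.subset_span ⟨p, hl p List.mem_cons_self, rfl⟩)
    convert sub_mem h1 h2 using 1
    ext y
    simp only [List.map_cons, List.prod_cons, Equiv.Perm.mul_apply, Pi.sub_apply, Pi.smul_apply,
      affineRoot_reflectRoot hP, affineRoot_wallReflection hP, smul_eq_mul]
    ring

/-- A common zero of simple affine roots whose gradients lie in an open half-space. -/
theorem exists_common_zero [Finite ι] [FiniteDimensional ℝ V] (hP : IsEuclidean P)
    (hx : x ∉ affineArrangement P) (hM : ∀ p ∈ M, IsSimpleAt P x p) {v : V}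
    (hv : ∀ p ∈ M, 0 < ⟪v, P.root p.1⟫_ℝ) : ∃ z, ∀ p ∈ M, affineRoot P p z = 0 := by
  have h : LinearIndependent ℝ fun p : M => P.root p.1.1 :=
    linearIndependent_of_inner_nonpos v _ (fun p => hv p p.2) fun p q hpq =>
      (hM p p.2).inner_nonpos hP hx (hM q q.2) (Subtype.coe_injective.ne hpq)
  obtain ⟨z, hz⟩ := exists_forall_inner_eq h fun p => (p.1.2 : ℝ)
  exact ⟨z, fun p hp => sub_eq_zero.mpr (hz ⟨p, hp⟩)⟩

/-- An affine root in the span of a set of simple affine roots is, up to sign, a sum of elements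
of that set. -/
theorem mem_addSubmonoidClosure_of_mem_span [Finite ι] [FiniteDimensional ℝ V]
    (hP : IsEuclidean P) (hx : x ∉ affineArrangement P) (hfin : M.Finite)
    (hM : ∀ p ∈ M, IsSimpleAt P x p) {v : V} (hv : ∀ p ∈ M, 0 < ⟪v, P.root p.1⟫_ℝ)
    {q : ι × ℤ} (hq : affineRoot P q ∈ Submodule.span ℝ (affineRoot P '' M))
    (hq0 : 0 < affineRoot P q x) :
    affineRoot P q ∈ AddSubmonoid.closure (affineRoot P '' M) := by
  obtain ⟨z, hz⟩ := exists_common_zero hP hx hM hv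
  -- Seen from the common zero `z`, affine roots in the span become linear, and `x - z` defines a
  -- half-space containing the gradients of those positive at `x`.
  have hzx : ∀ q, affineRoot P q ∈ Submodule.span ℝ (affineRoot P '' M) →
      ⟪x - z, P.root q.1⟫_ℝ = affineRoot P q x := by
    intro q hq
    have := eq_zero_of_mem_span hz hq
    simp only [affineRoot, inner_sub_left] at this ⊢
    linarith
  have hspan : ∀ p ∈ M, affineRoot P p ∈ Submodule.span ℝ (affineRoot P '' M) :=
    fun p hp => Submodule.subset_span ⟨p, hp, rfl⟩
  obtain ⟨δ, hδ, hδM⟩ : ∃ δ > 0, ∀ p ∈ M, δ ≤ affineRoot P p x := by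
    rcases M.eq_empty_or_nonempty with rfl | hne
    · exact ⟨1, one_pos, by simp⟩
    · obtain ⟨p, hp, hmin⟩ := hfin.exists_minimalFor (fun p => affineRoot P p x) M hne
      refine ⟨_, (hM p hp).1, fun p' hp' => ?_⟩
      by_contra! h
      exact absurd (hmin hp' h.le) (not_le.mpr h)
  -- If `q` made a nonacute angle with all of `M`, then adding `q` to `M` would keep the gradients
  -- independent, although `q` lies in the span.
  have step : ∀ q, affineRoot P q ∈ Submodule.span ℝ (affineRoot P '' M) →
      0 < affineRoot P q x → q ∉ M → ∃ p ∈ M, 0 < ⟪P.root q.1, P.root p.1⟫_ℝ := by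
    intro q hq hq0 hqM
    by_contra! hcon
    have h : LinearIndependent ℝ fun p : (insert q M : Set (ι × ℤ)) => P.root p.1.1 := by
      refine linearIndependent_of_inner_nonpos (x - z) _ ?_ ?_
      · rintro ⟨p, rfl | hp⟩
        · exact (hzx _ hq).symm ▸ hq0
        · exact (hzx _ (hspan p hp)).symm ▸ (hM p hp).1
      · rintro ⟨p, rfl | hp⟩ ⟨p', rfl | hp'⟩ hne
        · exact absurd rfl hne
        · exact hcon p' hp'
        · rw [real_inner_comm]; exact hcon p hp
        · exact (hM p hp).inner_nonpos hP hx (hM p' hp') fun h => hne (Subtype.ext h)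
    have h' := (linearIndepOn_insert hqM).mp (show LinearIndepOn ℝ (fun p : ι × ℤ => P.root p.1)
      (insert q M) from h)
    exact h'.2 (mem_span_root_of_mem_span hq)
  -- Each reflection in such a `p` subtracts a positive multiple of `p`, lowering the value at `x`
  -- by at least `δ` while keeping it positive; `n` bounds the number of descents.
  obtain ⟨n, hn⟩ := exists_nat_gt (affineRoot P q x / δ)
  rw [div_lt_iff₀ hδ] at hn
  induction n generalizing q with
  | zero => simp at hn; linarith
  | succ n ih =>
    by_cases hqM : q ∈ M
    · exact AddSubmonoid.subset_closure ⟨q, hqM, rfl⟩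
    obtain ⟨p, hp, hpq⟩ := step q hq hq0 hqM
    have hpos := (pairingIn_pos_iff hP).mpr hpq
    obtain ⟨m, hm⟩ := Int.eq_ofNat_of_zero_le hpos.le
    have hm1 : 1 ≤ m := by omega
    have e : affineRoot P (reflectRoot P p q) = affineRoot P q - m • affineRoot P p := by
      ext y
      rw [affineRoot_reflectRoot hP, affineRoot_wallReflection hP, hm]
      simp
    have h1 : affineRoot P (reflectRoot P p q) ∈ AddSubmonoid.closure (affineRoot P '' M) := by
      refine ih ?_ ?_ ?_
      · rw [e]
        exact sub_mem hq (nsmul_mem (hspan p hp) _)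
      · refine affineRoot_pos_of_not_neg hx fun h => ?_
        rw [affineRoot_reflectRoot hP] at h
        exact hqM ((hM p hp).2 q hq0 h ▸ hp)
      · rw [e]
        have h2 := hδM p hp
        have h3 : (1 : ℝ) ≤ m := by exact_mod_cast hm1
        rw [Pi.sub_apply, Pi.smul_apply, nsmul_eq_mul]
        push_cast at hn
        nlinarith
    have h2 : affineRoot P q = affineRoot P (reflectRoot P p q) + m • affineRoot P p := by
      rw [e]; abel
    rw [h2]
    exact add_mem h1 (nsmul_mem (AddSubmonoid.subset_closure (Set.mem_image_of_mem _ hp)) _)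

/-- An affine root separating `x` from `w x` lies in the span of the simple affine roots. -/
theorem mem_span_of_separates (hP : IsEuclidean P) (hx : x ∉ affineArrangement P)
    (hM : ∀ p ∈ M, IsSimpleAt P x p) {w : Equiv.Perm V}
    (hw : w ∈ Subgroup.closure (wallReflection P '' M)) {q : ι × ℤ}
    (hq : 0 < affineRoot P q x) (hq' : affineRoot P q (w x) < 0) :
    affineRoot P q ∈ Submodule.span ℝ (affineRoot P '' M) := by
  obtain ⟨l, hl, rfl, -⟩ := exists_reduced_word hw
  obtain ⟨l₁, p, l₂, rfl, h⟩ := exists_crossing hP hx hM hl hq hq'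
  have h1 : ∀ p ∈ l₁, p ∈ M := fun p hp => hl p (by simp [hp])
  have h2 := affineRoot_comp_sub_mem_span hP (prod_map_mem_closure (P := P) h1) q
  have h3 : affineRoot P p ∈ Submodule.span ℝ (affineRoot P '' M) :=
    Submodule.subset_span ⟨p, hl p (by simp), rfl⟩
  convert sub_mem h3 h2 using 1
  ext y
  simp [h]

/-- The images of `M` under the group vanish at the common zero `z`, so their signs at `w x` are
signs of roots on `w x - z`. There are finitely many sign patterns, and `w`, `w'` with the same
pattern satisfy `w⁻¹ w' = 1` by freeness. -/
theorem finite_closure [Finite ι] [FiniteDimensional ℝ V] (hP : IsEuclidean P)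
    (hx : x ∉ affineArrangement P) (hM : ∀ p ∈ M, IsSimpleAt P x p) {v : V}
    (hv : ∀ p ∈ M, 0 < ⟪v, P.root p.1⟫_ℝ) :
    Finite (Subgroup.closure (wallReflection P '' M)) := by
  obtain ⟨z, hz⟩ := exists_common_zero hP hx hM hv
  have hcomp : ∀ w ∈ Subgroup.closure (wallReflection P '' M), ∀ p ∈ M, ∃ q,
      (∀ y, affineRoot P q (w y) = affineRoot P p y) ∧ affineRoot P q z = 0 := by
    intro w hw p hp
    obtain ⟨q, hq, -⟩ := exists_affineRoot_conj hP (closure_le_affineWeylGroup M hw) p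
    refine ⟨q, hq, ?_⟩
    have h := eq_zero_of_mem_span hz (affineRoot_comp_sub_mem_span hP (inv_mem hw) p)
    have e : affineRoot P q z = affineRoot P p (w⁻¹ z) := by
      rw [← hq, ← Equiv.Perm.mul_apply, mul_inv_cancel]; rfl
    simp only [hz p hp] at h
    linarith
  refine Finite.of_injective (β := Set ι)
    (fun w => {α | 0 < ⟪w.1 x - z, P.root α⟫_ℝ}) fun w w' h => ?_
  have : w.1⁻¹ * w'.1 = 1 := by
    refine eq_one_of_forall_pos hP hx hM (mul_mem (inv_mem w.2) w'.2) fun p hp => ?_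
    obtain ⟨q, hq, hqz⟩ := hcomp w.1 w.2 p hp
    have hval : ∀ y, ⟪y - z, P.root q.1⟫_ℝ = affineRoot P q y := by
      intro y
      simp only [affineRoot, inner_sub_left] at hqz ⊢
      linarith
    have h1 : q.1 ∈ {α | 0 < ⟪w.1 x - z, P.root α⟫_ℝ} := by
      change 0 < ⟪w.1 x - z, P.root q.1⟫_ℝ
      rw [hval, hq]
      exact (hM p hp).1
    have h2 : q.1 ∈ {α | 0 < ⟪w'.1 x - z, P.root α⟫_ℝ} := (Set.ext_iff.mp h q.1).mp h1
    change 0 < ⟪w'.1 x - z, P.root q.1⟫_ℝ at h2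
    rw [hval] at h2
    rw [← hq, Equiv.Perm.mul_apply, ← Equiv.Perm.mul_apply w.1, mul_inv_cancel]
    exact h2
  exact Subtype.ext (inv_mul_eq_one.mp this)

/-- An element sending `x` to the opposite side of all the simple affine roots is unique. -/
theorem eq_of_forall_neg [Finite ι] [FiniteDimensional ℝ V]
    (hP : IsEuclidean P) (hx : x ∉ affineArrangement P) (hfin : M.Finite)
    (hM : ∀ p ∈ M, IsSimpleAt P x p) {v : V} (hv : ∀ p ∈ M, 0 < ⟪v, P.root p.1⟫_ℝ)
    {w w' : Equiv.Perm V} (hw : w ∈ Subgroup.closure (wallReflection P '' M))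
    (hw' : w' ∈ Subgroup.closure (wallReflection P '' M))
    (h : ∀ p ∈ M, affineRoot P p (w x) < 0) (h' : ∀ p ∈ M, affineRoot P p (w' x) < 0) :
    w = w' := by
  have : w⁻¹ * w' = 1 := by
    refine eq_one_of_forall_pos hP hx hM (mul_mem (inv_mem hw) hw') fun p hp => ?_
    obtain ⟨q, hq, -⟩ := exists_affineRoot_conj hP (closure_le_affineWeylGroup M hw) p
    have hqspan : affineRoot P q ∈ Submodule.span ℝ (affineRoot P '' M) := by
      have h1 := affineRoot_comp_sub_mem_span hP (inv_mem hw) p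
      have h2 : affineRoot P p ∈ Submodule.span ℝ (affineRoot P '' M) :=
        Submodule.subset_span ⟨p, hp, rfl⟩
      convert add_mem h1 h2 using 1
      ext y
      simp only [Pi.add_apply, sub_add_cancel]
      rw [← hq, ← Equiv.Perm.mul_apply, mul_inv_cancel]; rfl
    have hqw : 0 < affineRoot P q (w x) := by rw [hq]; exact (hM p hp).1
    -- Here `q` is `p` transported by `w`. Were `q` positive at `x`, it would be a sum of elements
    -- of `M` and so nonpositive at `w x`. Hence `-q` is such a sum, nonpositive at `w' x`.
    have hqx : affineRoot P q x < 0 := by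
      refine affineRoot_neg_of_not_pos hx fun h0 => ?_
      exact absurd hqw (not_lt.mpr (nonpos_of_mem_addSubmonoidClosure h
        (mem_addSubmonoidClosure_of_mem_span hP hx hfin hM hv hqspan h0)))
    have hneg : affineRoot P (negRoot P q) = -affineRoot P q := by
      ext y; exact affineRoot_negRoot q y
    have h3 := nonpos_of_mem_addSubmonoidClosure h'
      (mem_addSubmonoidClosure_of_mem_span hP hx hfin hM hv (q := negRoot P q)
        (by rw [hneg]; exact neg_mem hqspan) (by rw [affineRoot_negRoot]; linarith))
    rw [← hq, Equiv.Perm.mul_apply, ← Equiv.Perm.mul_apply w, mul_inv_cancel]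
    refine affineRoot_pos_of_not_neg
      (apply_notMem_affineArrangement hP (closure_le_affineWeylGroup M hw') hx) fun h4 => ?_
    rw [affineRoot_negRoot] at h3
    exact absurd h4 (not_lt.mpr (by simpa using h3))
  exact inv_mul_eq_one.mp this

/-- If `p` were positive at `w x`, it would be negative at `s_p w x`, and exchange would make `w =
s_p (s_p w)` shorter than `s_p w`. -/
theorem IsLongest.forall_neg (hP : IsEuclidean P) (hx : x ∉ affineArrangement P)
    (hM : ∀ p ∈ M, IsSimpleAt P x p) {w : Equiv.Perm V}
    (hw : IsLongest (wallReflection P '' M) w) {p : ι × ℤ} (hp : p ∈ M) :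
    affineRoot P p (w x) < 0 := by
  refine affineRoot_neg_of_not_pos
    (apply_notMem_affineArrangement hP (closure_le_affineWeylGroup M hw.1) hx) fun h => ?_
  have hmem : wallReflection P p * w ∈ Subgroup.closure (wallReflection P '' M) :=
    mul_mem (Subgroup.subset_closure ⟨p, hp, rfl⟩) hw.1
  have h1 := wordLength_wallReflection_mul_lt hP hx hM hmem (hM p hp).1 (by
    rw [Equiv.Perm.mul_apply, affineRoot_wallReflection_self hP]; linarith)
  rw [← mul_assoc, wallReflection_mul_self, one_mul] at h1
  exact absurd (hw.2 _ hmem) (not_le.mpr h1)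

/-- Finiteness gives existence. Any longest element puts `x` on the negative side of all of `M`, and
only one element does so. -/
theorem exists_longest [Finite ι] [FiniteDimensional ℝ V]
    (hP : IsEuclidean P) (hx : x ∉ affineArrangement P) (hfin : M.Finite)
    (hM : ∀ p ∈ M, IsSimpleAt P x p) {v : V} (hv : ∀ p ∈ M, 0 < ⟪v, P.root p.1⟫_ℝ) :
    ∃ w₀, ∀ w, IsLongest (wallReflection P '' M) w ↔ w = w₀ := by
  have := finite_closure hP hx hM hv
  obtain ⟨w, hw⟩ := Finite.exists_max fun w : Subgroup.closure (wallReflection P '' M) =>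
    wordLength (wallReflection P '' M) w.1
  have hlong : IsLongest (wallReflection P '' M) w.1 := ⟨w.2, fun u hu => hw ⟨u, hu⟩⟩
  have huniq : ∀ u, IsLongest (wallReflection P '' M) u → u = w.1 := fun u hu =>
    eq_of_forall_neg hP hx hfin hM hv hu.1 w.2 (fun p hp => hu.forall_neg hP hx hM hp)
      fun p hp => hlong.forall_neg hP hx hM hp
  exact ⟨w.1, fun u => ⟨huniq u, fun h => h ▸ hlong⟩⟩

theorem IsLongest.neg_of_mem_span [Finite ι] [FiniteDimensional ℝ V]
    (hP : IsEuclidean P) (hx : x ∉ affineArrangement P) (hfin : M.Finite)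
    (hM : ∀ p ∈ M, IsSimpleAt P x p) {v : V} (hv : ∀ p ∈ M, 0 < ⟪v, P.root p.1⟫_ℝ)
    {w : Equiv.Perm V} (hw : IsLongest (wallReflection P '' M) w) {q : ι × ℤ}
    (hq : affineRoot P q ∈ Submodule.span ℝ (affineRoot P '' M)) (hq0 : 0 < affineRoot P q x) :
    affineRoot P q (w x) < 0 := by
  refine affineRoot_neg_of_not_pos
    (apply_notMem_affineArrangement hP (closure_le_affineWeylGroup M hw.1) hx) (not_lt.mpr ?_)
  exact nonpos_of_mem_addSubmonoidClosure (fun p hp => hw.forall_neg hP hx hM hp)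
    (mem_addSubmonoidClosure_of_mem_span hP hx hfin hM hv hq hq0)

/-- The longest element turns simple affine roots at `x` into negatives of simple affine roots. -/
theorem IsLongest.isSimpleAt_negRoot [Finite ι] [FiniteDimensional ℝ V]
    (hP : IsEuclidean P) (hx : x ∉ affineArrangement P) (hfin : M.Finite)
    (hM : ∀ p ∈ M, IsSimpleAt P x p) {v : V} (hv : ∀ p ∈ M, 0 < ⟪v, P.root p.1⟫_ℝ)
    {w : Equiv.Perm V} (hw : IsLongest (wallReflection P '' M) w) {p : ι × ℤ} (hp : p ∈ M) :
    IsSimpleAt P (w x) (negRoot P p) := by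
  refine ⟨by rw [affineRoot_negRoot]; linarith [hw.forall_neg hP hx hM hp], fun q hq hq' => ?_⟩
  rw [wallReflection_negRoot] at hq'
  have hwa := closure_le_affineWeylGroup M hw.1
  have hsp : wallReflection P p ∈ Subgroup.closure (wallReflection P '' M) :=
    Subgroup.subset_closure ⟨p, hp, rfl⟩
  -- Pulled back by `w`, the affine root `q` separates `x` from its image under `w⁻¹ s_p w`, so it
  -- lies in the span.
  have hspan : affineRoot P q ∈ Submodule.span ℝ (affineRoot P '' M) := by
    obtain ⟨q₀, hq₀, -⟩ := exists_affineRoot_conj hP (inv_mem hwa) q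
    have e : ∀ y, affineRoot P q₀ y = affineRoot P q (w y) := fun y => by
      rw [← hq₀, ← Equiv.Perm.mul_apply, inv_mul_cancel]; rfl
    have h1 := mem_span_of_separates hP hx hM (q := q₀)
      (mul_mem (inv_mem hw.1) (mul_mem hsp hw.1)) (by rwa [e]) (by
        rw [e, Equiv.Perm.mul_apply, ← Equiv.Perm.mul_apply w, mul_inv_cancel]
        exact hq')
    convert sub_mem h1 (affineRoot_comp_sub_mem_span hP hw.1 q) using 1
    ext y
    simp [e]
  have hspan' : affineRoot P (reflectRoot P p q) ∈ Submodule.span ℝ (affineRoot P '' M) := by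
    convert add_mem (affineRoot_comp_sub_mem_span hP hsp q) hspan using 1
    ext y
    simp [affineRoot_reflectRoot hP]
  -- As `w` flips every affine root of the span, the signs of `q` and `s_p q` at `x` are opposite to
  -- those at `w x`. So `-q` is positive at `x`, flipped by `s_p`, and equals `p`.
  have h1 : affineRoot P q x < 0 := affineRoot_neg_of_not_pos hx fun h =>
    absurd hq (hw.neg_of_mem_span hP hx hfin hM hv hspan h).not_gt
  have h2 : 0 < affineRoot P q (wallReflection P p x) := by
    rw [← affineRoot_reflectRoot hP] at hq' ⊢
    refine affineRoot_pos_of_not_neg hx fun h => ?_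
    have hneg : affineRoot P (negRoot P (reflectRoot P p q)) =
        -affineRoot P (reflectRoot P p q) := by
      ext y; exact affineRoot_negRoot _ y
    have h3 := hw.neg_of_mem_span hP hx hfin hM hv (q := negRoot P (reflectRoot P p q))
      (by rw [hneg]; exact neg_mem hspan') (by rw [affineRoot_negRoot]; linarith)
    rw [affineRoot_negRoot] at h3
    linarith
  rw [← (hM p hp).2 (negRoot P q) (by rw [affineRoot_negRoot]; linarith)
    (by rw [affineRoot_negRoot]; linarith), negRoot_negRoot]

end Parabolic

/-! ### Connected components of complements of arrangements -/

theorem continuous_affineRoot (p : ι × ℤ) : Continuous (affineRoot P p) := by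
  unfold affineRoot
  fun_prop

theorem affineRoot_combination (p : ι × ℤ) (x y : V) {a b : ℝ} (hab : a + b = 1) :
    affineRoot P p (a • x + b • y) = a * affineRoot P p x + b * affineRoot P p y := by
  simp only [affineRoot, inner_add_left, real_inner_smul_left]
  linear_combination (p.2 : ℝ) * hab

/-- The points on the same side as `x` of every hyperplane of `𝓗`. -/
def sideSet (P : RootPairing ι ℝ V N) (𝓗 : Set (ι × ℤ)) (x : V) : Set V :=
  {y | ∀ p ∈ 𝓗, 0 < affineRoot P p x → 0 < affineRoot P p y}

theorem convex_sideSet (𝓗 : Set (ι × ℤ)) (x : V) : Convex ℝ (sideSet P 𝓗 x) := by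
  rw [convex_iff_forall_pos]
  intro y hy z hz a b ha hb hab p hp hpx
  rw [affineRoot_combination p y z hab]
  have := mul_pos ha (hy p hp hpx)
  have := mul_pos hb (hz p hp hpx)
  linarith

theorem mem_sideSet_self (𝓗 : Set (ι × ℤ)) (x : V) : x ∈ sideSet P 𝓗 x := fun _ _ h => h

/-- A side set is convex, and on a connected component an affine root of `𝓗` cannot change sign
without vanishing. Closure of `𝓗` under negation lets the one-sided definition control both signs.
-/
theorem connectedComponentIn_eq_sideSet {𝓗 : Set (ι × ℤ)} (hsymm : ∀ p ∈ 𝓗, negRoot P p ∈ 𝓗)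
    {x : V} (hx : ∀ p ∈ 𝓗, affineRoot P p x ≠ 0) :
    connectedComponentIn {y | ∀ p ∈ 𝓗, affineRoot P p y ≠ 0} x = sideSet P 𝓗 x := by
  apply subset_antisymm
  · intro y hy p hp hpx
    by_contra hcon
    have hpre := (isPreconnected_connectedComponentIn (F := {y | ∀ p ∈ 𝓗, affineRoot P p y ≠ 0})
      (x := x)).image (affineRoot P p) (continuous_affineRoot p).continuousOn
    have h0 := hpre.ordConnected.out ⟨y, hy, rfl⟩
      ⟨x, mem_connectedComponentIn (F := {y | ∀ p ∈ 𝓗, affineRoot P p y ≠ 0}) hx, rfl⟩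
      ⟨not_lt.mp hcon, hpx.le⟩
    obtain ⟨z, hz, hz0⟩ := h0
    exact connectedComponentIn_subset _ _ hz p hp hz0
  · refine (convex_sideSet 𝓗 x).isPreconnected.subset_connectedComponentIn
      (mem_sideSet_self 𝓗 x) fun y hy p hp => ?_
    rcases lt_or_gt_of_ne (hx p hp) with h | h
    · have := hy _ (hsymm p hp) (by rw [affineRoot_negRoot]; linarith)
      rw [affineRoot_negRoot] at this
      exact (by linarith : affineRoot P p y < 0).ne
    · exact (hy p hp h).ne'

theorem sideSet_eq_of_mem {𝓗 : Set (ι × ℤ)} (hsymm : ∀ p ∈ 𝓗, negRoot P p ∈ 𝓗)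
    {x y : V} (hx : ∀ p ∈ 𝓗, affineRoot P p x ≠ 0) (hy : y ∈ sideSet P 𝓗 x) :
    sideSet P 𝓗 y = sideSet P 𝓗 x := by
  ext z
  refine ⟨fun hz p hp hpx => hz p hp (hy p hp hpx), fun hz p hp hpy => hz p hp ?_⟩
  by_contra hcon
  have h := lt_of_le_of_ne (not_lt.mp hcon) (hx p hp)
  have := hy _ (hsymm p hp) (by rw [affineRoot_negRoot]; linarith)
  rw [affineRoot_negRoot] at this
  linarith

/-- The affine roots vanishing on hyperplanes of the `k`-Catalan arrangement. -/
def catalanRoots (ι : Type*) (k : ℕ) : Set (ι × ℤ) := {p | |p.2| ≤ k}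

theorem negRoot_mem_catalanRoots {k : ℕ} {p : ι × ℤ} (hp : p ∈ catalanRoots ι k) :
    negRoot P p ∈ catalanRoots ι k := by
  simpa [catalanRoots, negRoot] using hp

/-- A negative offset for `α` is a positive offset for `-α`, hence the absolute value in
`catalanRoots`. -/
theorem compl_catalanArrangement (k : ℕ) :
    (catalanArrangement P k)ᶜ = {y | ∀ p ∈ catalanRoots ι k, affineRoot P p y ≠ 0} := by
  ext y
  simp only [Set.mem_compl_iff, Set.mem_ofPred_eq]
  constructor
  · intro h p hp h0
    simp only [catalanRoots, Set.mem_ofPred_eq, abs_le] at hp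
    rcases le_total 0 p.2 with hr | hr
    · exact h ⟨p.1, p.2, hr, hp.2, sub_eq_zero.mp h0⟩
    · refine h ⟨(negRoot P p).1, (negRoot P p).2, ?_, ?_, sub_eq_zero.mp ?_⟩
      · simpa [negRoot] using hr
      · simp only [negRoot]; omega
      · change affineRoot P (negRoot P p) y = 0
        rw [affineRoot_negRoot, h0, neg_zero]
  · rintro h ⟨α, r, h0, hk, hy⟩
    exact h (α, r) (by simpa [catalanRoots, abs_of_nonneg h0] using hk) (sub_eq_zero.mpr hy)

theorem compl_affineArrangement :
    (affineArrangement P)ᶜ = {y | ∀ p ∈ (Set.univ : Set (ι × ℤ)), affineRoot P p y ≠ 0} := by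
  ext y
  simp [notMem_affineArrangement_iff]

theorem notMem_catalanArrangement {k : ℕ} {x : V} (hx : x ∉ affineArrangement P) :
    x ∉ catalanArrangement P k := fun ⟨α, r, _, _, h⟩ => hx ⟨α, r, h⟩

theorem IsRegion.eq_sideSet {k : ℕ} {R : Set V} (hR : IsRegion P k R) {x : V} (hx : x ∈ R) :
    R = sideSet P (catalanRoots ι k) x := by
  obtain ⟨z, hz, rfl⟩ := hR
  rw [compl_catalanArrangement] at hz hx ⊢
  rw [connectedComponentIn_eq_sideSet (fun p => negRoot_mem_catalanRoots) hz] at hx ⊢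
  exact (sideSet_eq_of_mem (fun p => negRoot_mem_catalanRoots) hz hx).symm

theorem isRegion_sideSet {k : ℕ} {x : V} (hx : x ∉ catalanArrangement P k) :
    IsRegion P k (sideSet P (catalanRoots ι k) x) := by
  refine ⟨x, hx, ?_⟩
  have hx' : x ∈ (catalanArrangement P k)ᶜ := hx
  rw [compl_catalanArrangement] at hx' ⊢
  exact (connectedComponentIn_eq_sideSet (fun p => negRoot_mem_catalanRoots) hx').symm

theorem IsRegion.affineRoot_ne_zero {k : ℕ} {R : Set V} (hR : IsRegion P k R) {x : V}
    (hx : x ∈ R) {p : ι × ℤ} (hp : p ∈ catalanRoots ι k) : affineRoot P p x ≠ 0 := by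
  obtain ⟨z, hz, rfl⟩ := hR
  have := connectedComponentIn_subset _ _ hx
  rw [compl_catalanArrangement] at this
  exact this p hp

/-- The alcove of a generic point. -/
def cell (P : RootPairing ι ℝ V N) (x : V) : Set V :=
  {y | ∀ α, 0 < affineRoot P (α, level P x α) y}

theorem cell_eq_sideSet {x : V} (hx : x ∉ affineArrangement P) :
    cell P x = sideSet P Set.univ x := by
  ext y
  refine ⟨fun hy p _ hp => ?_, fun hy α => hy _ trivial (affineRoot_level_pos hx α)⟩
  have h1 := (le_level_iff hx).mpr hp
  have h2 := hy p.1
  have h3 : (p.2 : ℝ) ≤ level P x p.1 := by exact_mod_cast h1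
  simp only [affineRoot] at h2 ⊢
  linarith

theorem isAlcove_cell {x : V} (hx : x ∉ affineArrangement P) : IsAlcove P (cell P x) := by
  refine ⟨x, hx, ?_⟩
  rw [cell_eq_sideSet hx, compl_affineArrangement]
  exact (connectedComponentIn_eq_sideSet (fun p _ => Set.mem_univ (negRoot P p))
    fun p _ => affineRoot_ne_zero hx p).symm

theorem cell_subset_sideSet {x : V} (hx : x ∉ affineArrangement P) (𝓗 : Set (ι × ℤ)) :
    cell P x ⊆ sideSet P 𝓗 x := by
  rw [cell_eq_sideSet hx]
  exact fun y hy p _ => hy p trivial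

theorem image_cell (hP : IsEuclidean P) [P.IsCrystallographic] {u : Equiv.Perm V}
    (hu : u ∈ affineWeylGroup P) {x : V} (hx : x ∉ affineArrangement P) :
    u '' cell P x = cell P (u x) := by
  rw [cell_eq_sideSet hx, cell_eq_sideSet (apply_notMem_affineArrangement hP hu hx)]
  ext y
  rw [Equiv.image_eq_preimage_symm, Set.mem_preimage]
  constructor
  · intro hy p _ hp
    obtain ⟨q, hq, -⟩ := exists_affineRoot_conj hP (inv_mem hu) p
    have e : ∀ y, affineRoot P q y = affineRoot P p (u y) := fun y => by
      rw [← hq, ← Equiv.Perm.mul_apply, inv_mul_cancel]; rfl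
    rw [← e] at hp
    have := hy q trivial hp
    rwa [e, Equiv.apply_symm_apply] at this
  · intro hy p _ hp
    obtain ⟨q, hq, -⟩ := exists_affineRoot_conj hP hu p
    rw [← hq] at hp ⊢
    rw [Equiv.apply_symm_apply]
    exact hy q trivial hp

theorem level_eq_of_mem_cell {x y : V} (hx : x ∉ affineArrangement P) (hy : y ∈ cell P x)
    (α : ι) : level P y α = level P x α := by
  have h1 := hy α
  have h2 := hy (P.reflectionPerm α α)
  rw [level_neg hx] at h2
  simp only [affineRoot, root_negIndex, inner_neg_right] at h1 h2
  push_cast at h2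
  rw [level, Int.floor_eq_iff]
  constructor <;> linarith

theorem cell_congr {x y : V} (h : ∀ α, level P x α = level P y α) : cell P x = cell P y := by
  simp only [cell, h]

/-! ### Walls -/

/-- The hyperplane `H_α^r` as an affine subspace. -/
def hyperplaneSubspace (P : RootPairing ι ℝ V N) (α : ι) (r : ℤ) : AffineSubspace ℝ V where
  carrier := hyperplane P α r
  smul_vsub_vadd_mem' c p₁ p₂ p₃ h₁ h₂ h₃ := by
    simp only [hyperplane, Set.mem_ofPred_eq, vsub_eq_sub, vadd_eq_add, inner_add_left,
      real_inner_smul_left, inner_sub_left] at *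
    rw [h₁, h₂, h₃]
    ring

theorem hyperplane_negRoot (p : ι × ℤ) :
    hyperplane P (negRoot P p).1 (negRoot P p).2 = hyperplane P p.1 p.2 := by
  ext y
  simp only [hyperplane, Set.mem_ofPred_eq, negRoot, root_negIndex, inner_neg_right]
  push_cast
  exact neg_inj

theorem mem_closure_cell {x y : V} (hx : x ∉ affineArrangement P)
    (hy : ∀ α, 0 ≤ affineRoot P (α, level P x α) y) : y ∈ closure (cell P x) := by
  have hcont : Continuous fun t : ℝ => (1 - t) • y + t • x := by fun_prop
  have hlim : Filter.Tendsto (fun t : ℝ => (1 - t) • y + t • x) (nhdsWithin 0 (Set.Ioo 0 1))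
      (nhds y) := by
    have := hcont.tendsto 0
    simp only [sub_zero, one_smul, zero_smul, add_zero] at this
    exact this.mono_left nhdsWithin_le_nhds
  have : (nhdsWithin (0 : ℝ) (Set.Ioo 0 1)).NeBot :=
    left_nhdsWithin_Ioo_neBot one_pos
  refine mem_closure_of_tendsto hlim ?_
  filter_upwards [self_mem_nhdsWithin] with t ht α
  rw [affineRoot_combination _ _ _ (by ring)]
  have h1 := mul_nonneg (sub_nonneg.mpr ht.2.le) (hy α)
  have h2 := mul_pos ht.1 (affineRoot_level_pos hx α)
  linarith

theorem affineRoot_nonneg_of_mem_closure {R : Set V} {p : ι × ℤ}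
    (h : ∀ y ∈ R, 0 < affineRoot P p y) {y : V} (hy : y ∈ closure R) : 0 ≤ affineRoot P p y :=
  closure_minimal (fun y hy => (h y hy).le)
    (isClosed_Ici.preimage (continuous_affineRoot p)) hy

theorem IsSimpleAt.isWall [Finite ι] (hP : IsEuclidean P) [P.IsCrystallographic] {x : V}
    (hx : x ∉ affineArrangement P) {p : ι × ℤ} (hp : IsSimpleAt P x p) :
    IsWall P (cell P x) p.1 p.2 := by
  have hlev := hp.eq_level hP hx
  refine ⟨Set.disjoint_left.mpr fun y hy hy' => ?_, ?_⟩
  · have := hy p.1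
    rw [← hlev] at this
    exact this.ne' (sub_eq_zero.mpr hy')
  apply subset_antisymm
  · exact affineSpan_le (Q := hyperplaneSubspace P p.1 p.2).mpr Set.inter_subset_right
  -- The midpoint of `x` and its mirror image lies on the wall and strictly inside every other
  -- bounding half-space.
  set x₀ : V := (1 / 2 : ℝ) • x + (1 / 2 : ℝ) • wallReflection P p x with hx₀
  have hval : ∀ q, affineRoot P q x₀ =
      1 / 2 * affineRoot P q x + 1 / 2 * affineRoot P q (wallReflection P p x) := fun q =>
    affineRoot_combination q _ _ (by norm_num)
  have hp0 : affineRoot P p x₀ = 0 := by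
    rw [hval, affineRoot_wallReflection_self hP]; ring
  have hpos : ∀ α, α ≠ p.1 → 0 < affineRoot P (α, level P x α) x₀ := by
    intro α hα
    rw [hval]
    have h1 := affineRoot_level_pos hx α
    have h2 := not_lt.mp fun h => hα (congrArg Prod.fst (hp.2 _ h1 h))
    linarith
  have hmem : ∀ y, y ∈ hyperplane P p.1 p.2 → (∀ α, α ≠ p.1 → 0 < affineRoot P (α, level P x α) y) →
      y ∈ closure (cell P x) ∩ hyperplane P p.1 p.2 := by
    refine fun y hy h => ⟨mem_closure_cell hx fun α => ?_, hy⟩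
    by_cases hα : α = p.1
    · rw [hα, ← hlev]
      exact (sub_eq_zero.mpr hy).ge
    · exact (h α hα).le
  have hx₀H : x₀ ∈ hyperplane P p.1 p.2 := sub_eq_zero.mp hp0
  intro y hy
  -- A point of the hyperplane close enough to `x₀` stays in the closed alcove; extending the line
  -- from `x₀` through it by the factor `t⁻¹` reaches `y`.
  have hev : ∀ᶠ t : ℝ in nhdsWithin 0 (Set.Ioi 0), ∀ α, α ≠ p.1 →
      0 < affineRoot P (α, level P x α) ((1 - t) • x₀ + t • y) := by
    rw [Filter.eventually_all]
    intro α
    by_cases hα : α = p.1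
    · exact Filter.Eventually.of_forall fun t h => absurd hα h
    have hcont : Continuous fun t : ℝ =>
        affineRoot P (α, level P x α) ((1 - t) • x₀ + t • y) :=
      (continuous_affineRoot _).comp (by fun_prop)
    have h0 := hcont.tendsto 0
    simp only [sub_zero, one_smul, zero_smul, add_zero] at h0
    filter_upwards [nhdsWithin_le_nhds (h0.eventually (lt_mem_nhds (hpos α hα)))] with t ht _
    exact ht
  obtain ⟨t, ht, ht0⟩ := (hev.and self_mem_nhdsWithin).exists
  have ht0' : (0 : ℝ) < t := ht0
  have h1 := subset_affineSpan ℝ _ (hmem x₀ hx₀H hpos)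
  have h2 := subset_affineSpan ℝ _ (hmem ((1 - t) • x₀ + t • y) (by
    have h3 : ⟪x₀, P.root p.1⟫_ℝ = p.2 := hx₀H
    have h4 : ⟪y, P.root p.1⟫_ℝ = p.2 := hy
    simp only [hyperplane, Set.mem_ofPred_eq, inner_add_left, real_inner_smul_left, h3, h4]
    ring) ht)
  have h3 := AffineMap.lineMap_mem t⁻¹ h1 h2
  have : (1 - t) • x₀ + t • y - x₀ = t • (y - x₀) := by module
  rwa [AffineMap.lineMap_apply_module', this, smul_smul, inv_mul_cancel₀ ht0'.ne', one_smul,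
    sub_add_cancel] at h3

/-- The affine root of a wall of `R` is not the sum of two affine roots that are positive on `R`. -/
theorem IsWall.not_decomposable [P.IsReduced] {R : Set V} {p q r : ι × ℤ}
    (hR : IsWall P R p.1 p.2) (hq : ∀ y ∈ R, 0 < affineRoot P q y)
    (hr : ∀ y ∈ R, 0 < affineRoot P r y) :
    ¬ ∀ y, affineRoot P p y = affineRoot P q y + affineRoot P r y := by
  intro h
  have key : ∀ q r : ι × ℤ, (∀ y ∈ R, 0 < affineRoot P q y) → (∀ y ∈ R, 0 < affineRoot P r y) →
      (∀ y, affineRoot P p y = affineRoot P q y + affineRoot P r y) →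
      P.root q.1 = P.root p.1 ∨ P.root q.1 = -P.root p.1 := by
    intro q r hq hr h
    -- Two nonnegative summands of zero vanish on the face, hence on its affine span. This
    -- containment of hyperplanes makes the gradients proportional.
    have hsub : hyperplane P p.1 p.2 ⊆ hyperplane P q.1 q.2 := by
      rw [← hR.2]
      refine affineSpan_le (Q := hyperplaneSubspace P q.1 q.2).mpr fun y hy => ?_
      have h1 := affineRoot_nonneg_of_mem_closure hq hy.1
      have h2 := affineRoot_nonneg_of_mem_closure hr hy.1
      have h3 : affineRoot P p y = 0 := sub_eq_zero.mpr hy.2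
      have h4 := h y
      exact sub_eq_zero.mp (show affineRoot P q y = 0 by linarith)
    have h0 := (inner_root_self_pos (P := P) p.1).ne'
    set a := P.root p.1 with ha
    set c := ⟪P.root q.1, a⟫_ℝ / ⟪a, a⟫_ℝ with hc
    set u := P.root q.1 - c • a with hu
    have hua : ⟪u, a⟫_ℝ = 0 := by
      rw [hu, inner_sub_left, real_inner_smul_left, hc]
      field_simp
      ring
    set y₀ := ((p.2 : ℝ) / ⟪a, a⟫_ℝ) • a with hy₀
    have h1 : ⟪y₀, P.root q.1⟫_ℝ = q.2 := hsub (by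
      simp only [hyperplane, Set.mem_ofPred_eq, hy₀, real_inner_smul_left, ← ha]
      field_simp)
    -- Translation by `u`, the part of the gradient of `q` orthogonal to `a`, stays in the
    -- hyperplane of `p`. So `u` is orthogonal to that gradient and must vanish.
    have h2 : ⟪y₀ + u, P.root q.1⟫_ℝ = q.2 := hsub (by
      simp only [hyperplane, Set.mem_ofPred_eq, hy₀, inner_add_left, real_inner_smul_left, ← ha, hua]
      field_simp
      ring)
    have h3 : ⟪u, u⟫_ℝ = 0 := by
      rw [inner_add_left] at h2
      have h4 : ⟪u, P.root q.1 - c • a⟫_ℝ = 0 := by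
        rw [inner_sub_right, real_inner_smul_right, hua]
        linarith
      exact h4
    have h4 : P.root q.1 = c • a := sub_eq_zero.mp (inner_self_eq_zero.mp h3)
    refine RootPairing.IsReduced.eq_or_eq_neg (P := P) q.1 p.1 ?_
    rw [LinearIndependent.pair_iff]
    push Not
    exact ⟨1, -c, by rw [h4]; module, by simp⟩
  have e := (root_eq_and_eq_of_affineRoot_eq_add h).1
  have hne := P.ne_zero p.1
  rcases key q r hq hr h with h1 | h1 <;>
    rcases key r q hr hq (fun y => by rw [h y, add_comm]) with h2 | h2 <;> rw [h1, h2] at e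
  · exact hne (by simpa using e)
  · exact hne (by simpa using e)
  · exact hne (by simpa using e)
  · have : (3 : ℝ) • P.root p.1 = 0 := by
      have e' : P.root p.1 - (-P.root p.1 + -P.root p.1) = 0 := sub_eq_zero.mpr e
      rw [← e']
      module
    simp [hne] at this

/-! ### Transitivity on alcoves -/

theorem IsSimpleAt.level_wallReflection_self (hP : IsEuclidean P) [P.IsCrystallographic] {x : V}
    {α : ι} (h : IsSimpleAt P x (α, level P x α)) :
    level P (wallReflection P (α, level P x α) x) α = level P x α - 1 := by
  have h1 := affineRoot_wallReflection_self hP (α, level P x α) x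
  have h2 := h.1
  have h3 := affineRoot_level_lt_one (P := P) x α
  simp only [affineRoot] at h1 h2 h3
  rw [level, Int.floor_eq_iff]
  push_cast
  constructor <;> linarith

/-- Simplicity prevents the level of any root other than `α` from dropping; applied to `-β`, this
also prevents the level of `β` from rising. -/
theorem IsSimpleAt.level_wallReflection_of_ne (hP : IsEuclidean P) [P.IsCrystallographic] {x : V}
    (hx : x ∉ affineArrangement P) {α β : ι} (h : IsSimpleAt P x (α, level P x α)) (h1 : β ≠ α)
    (h2 : β ≠ P.reflectionPerm α α) :
    level P (wallReflection P (α, level P x α) x) β = level P x β := by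
  have hy := apply_notMem_affineArrangement hP
    (wallReflection_mem_affineWeylGroup (P := P) (α, level P x α)) hx
  have key : ∀ γ, γ ≠ α → level P x γ ≤ level P (wallReflection P (α, level P x α) x) γ := by
    intro γ hγ
    rw [le_level_iff hy]
    refine affineRoot_pos_of_not_neg hy fun hneg => hγ ?_
    exact congrArg Prod.fst (h.2 _ (affineRoot_level_pos hx γ) hneg)
  have h3 := key β h1
  have h4 := key (P.reflectionPerm β β) (by
    rintro rfl
    exact h2 (P.root.injective (by rw [root_negIndex, root_negIndex, neg_neg])))
  rw [level_neg hx, level_neg hy] at h4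
  omega

/-- If all simple affine roots at `y` are positive at `z`, then `z` lies in the alcove of `y`. -/
theorem mem_cell_of_forall_isSimpleAt [Finite ι] (hP : IsEuclidean P) [P.IsCrystallographic]
    [P.IsReduced] {y z : V} (hy : y ∉ affineArrangement P)
    (h : ∀ α, IsSimpleAt P y (α, level P y α) → 0 < affineRoot P (α, level P y α) z) :
    z ∈ cell P y := by
  by_contra hcon
  have hne : {α | ¬ 0 < affineRoot P (α, level P y α) z}.Nonempty := by
    by_contra hemp
    exact hcon fun α => by_contra fun hα => hemp ⟨α, hα⟩
  -- Among the violated inequalities take the one smallest at `y`. If it is not simple, it is a sum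
  -- of two smaller ones, which hold at `z`.
  obtain ⟨α, hα, hmin⟩ := (Set.toFinite _).exists_minimalFor
    (fun α => affineRoot P (α, level P y α) y) _ hne
  have hlt : ∀ β, affineRoot P (β, level P y β) y < affineRoot P (α, level P y α) y →
      0 < affineRoot P (β, level P y β) z := fun β hβ =>
    by_contra fun hβ' => absurd (hmin hβ' hβ.le) hβ.not_ge
  refine hα (h α (isSimpleAt_of_indecomposable hP hy fun β γ e e' => hα ?_))
  have e1 := affineRoot_add e e'
  have h1 := affineRoot_level_pos hy β
  have h2 := affineRoot_level_pos hy γ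
  rw [e1 z]
  exact add_pos (hlt β (by rw [e1 y]; linarith)) (hlt γ (by rw [e1 y]; linarith))

/-- Minimise the total distance between the levels of `u x` and of `z`. A simple affine root at `u
x` that is negative at `z` would give a reflection moving the levels of `±α` one step towards `z`
and no others. -/
theorem exists_apply_mem_cell [Finite ι] (hP : IsEuclidean P) [P.IsCrystallographic]
    [P.IsReduced] {x z : V} (hx : x ∉ affineArrangement P) (hz : z ∉ affineArrangement P) :
    ∃ u ∈ affineWeylGroup P, z ∈ cell P (u x) := by
  have := Fintype.ofFinite ι
  let n : affineWeylGroup P → ℕ := fun u => ∑ β, (level P (u.1 x) β - level P z β).natAbs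
  obtain ⟨u, hu⟩ : ∃ u, ∀ u', n u ≤ n u' := by
    obtain ⟨u, hu⟩ := WellFounded.has_min (measure n).wf Set.univ ⟨1, trivial⟩
    exact ⟨u, fun u' => not_lt.mp (hu.2 u' trivial)⟩
  set y := u.1 x with hy_def
  have hy : y ∉ affineArrangement P := apply_notMem_affineArrangement hP u.2 hx
  suffices h : ∀ α, IsSimpleAt P y (α, level P y α) → 0 < affineRoot P (α, level P y α) z from
    ⟨u.1, u.2, mem_cell_of_forall_isSimpleAt hP hy h⟩
  intro α hα
  refine affineRoot_pos_of_not_neg hz fun hneg => ?_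
  have hlt : level P z α < level P y α := by
    by_contra! hle
    exact absurd ((le_level_iff hz).mp hle) hneg.not_gt
  have hs := wallReflection_mem_affineWeylGroup (P := P) (α, level P y α)
  have hy' := apply_notMem_affineArrangement hP hs hy
  have hself := hα.level_wallReflection_self hP
  refine absurd (hu ⟨_ * u.1, mul_mem hs u.2⟩) (not_le.mpr ?_)
  refine Finset.sum_lt_sum (fun β _ => ?_) ⟨α, Finset.mem_univ _, ?_⟩
  · change (level P (wallReflection P (α, level P y α) y) β - level P z β).natAbs ≤
      (level P y β - level P z β).natAbs
    by_cases h1 : β = α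
    · subst h1
      rw [hself]; omega
    by_cases h2 : β = P.reflectionPerm α α
    · subst h2
      rw [level_neg hy, level_neg hz, level_neg hy', hself]; omega
    rw [hα.level_wallReflection_of_ne hP hy h1 h2]
  · change (level P (wallReflection P (α, level P y α) y) α - level P z α).natAbs <
      (level P y α - level P z α).natAbs
    rw [hself]; omega

/-! ### Positive roots and the fundamental alcove -/

/-- This vector turns positivity of a root into the sign of an inner product, so the positive system
can later be reversed by passing to `-v`. -/
theorem exists_inner_eq_height [FiniteDimensional ℝ V] (b : P.Base) :
    ∃ v : V, ∀ α, ⟪v, P.root α⟫_ℝ = b.height α := by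
  obtain ⟨v, hv⟩ := exists_forall_inner_eq b.linearIndepOn_root fun _ => 1
  refine ⟨v, fun α => ?_⟩
  obtain ⟨f, -, -, hf⟩ := b.exists_root_eq_sum_int α
  rw [RootPairing.Base.height_eq_sum hf, hf, inner_sum, Int.cast_sum]
  refine Finset.sum_congr rfl fun j hj => ?_
  rw [← Int.cast_smul_eq_zsmul ℝ, real_inner_smul_right]
  have : ⟪v, P.root j⟫_ℝ = 1 := hv ⟨j, hj⟩
  rw [this, mul_one]

theorem isPos_or_isPos_neg (b : P.Base) (α : ι) :
    b.IsPos α ∨ b.IsPos (P.reflectionPerm α α) :=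
  RootPairing.Base.IsPos.or_neg b α

theorem mem_cell_iff_of_isPos (b : P.Base) {x y : V} (hx : x ∉ affineArrangement P) :
    y ∈ cell P x ↔ ∀ α, b.IsPos α →
      (level P x α : ℝ) < ⟪y, P.root α⟫_ℝ ∧ ⟪y, P.root α⟫_ℝ < level P x α + 1 := by
  constructor
  · intro h α _
    have h1 := h α
    have h2 := h (P.reflectionPerm α α)
    rw [level_neg hx] at h2
    simp only [affineRoot, root_negIndex, inner_neg_right] at h1 h2
    push_cast at h2
    constructor <;> linarith
  · intro h α
    rcases isPos_or_isPos_neg b α with hα | hα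
    · have := (h α hα).1
      simp only [affineRoot]
      linarith
    · have := (h _ hα).2
      rw [level_neg hx, root_negIndex, inner_neg_right] at this
      push_cast at this
      simp only [affineRoot]
      linarith

theorem exists_cell_eq_fundamentalAlcove [Finite ι] [FiniteDimensional ℝ V] (b : P.Base) :
    ∃ z, z ∉ affineArrangement P ∧ cell P z = fundamentalAlcove b := by
  obtain ⟨v, hv⟩ := exists_inner_eq_height b
  obtain ⟨C, hC⟩ := (Set.finite_range fun α => |(b.height α : ℝ)|).bddAbove
  have hC' : ∀ α, |(b.height α : ℝ)| < |C| + 1 := fun α =>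
    (hC ⟨α, rfl⟩).trans_lt ((le_abs_self C).trans_lt (lt_add_one _))
  have hpos : 0 < |C| + 1 := by positivity
  set z : V := (|C| + 1)⁻¹ • v with hz
  have hval : ∀ α, b.IsPos α → 0 < ⟪z, P.root α⟫_ℝ ∧ ⟪z, P.root α⟫_ℝ < 1 := by
    intro α hα
    have h1 : (0 : ℝ) < b.height α := by exact_mod_cast hα
    rw [hz, real_inner_smul_left, hv]
    refine ⟨by positivity, ?_⟩
    rw [inv_mul_lt_one₀ hpos]
    exact (le_abs_self _).trans_lt (hC' α)
  have hgen : z ∉ affineArrangement P := by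
    rintro ⟨α, r, hr⟩
    have hr' : ⟪z, P.root α⟫_ℝ = r := hr
    rcases isPos_or_isPos_neg b α with hα | hα
    · have := hval α hα
      rw [hr'] at this
      have h1 : 0 < r := by exact_mod_cast this.1
      have h2 : r < 1 := by exact_mod_cast this.2
      omega
    · have := hval _ hα
      rw [root_negIndex, inner_neg_right, hr'] at this
      have h1 : 0 < -r := by exact_mod_cast this.1
      have h2 : -r < 1 := by exact_mod_cast this.2
      omega
  refine ⟨z, hgen, ?_⟩
  ext y
  rw [mem_cell_iff_of_isPos b hgen]
  have hlev : ∀ α, b.IsPos α → level P z α = 0 := by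
    intro α hα
    rw [level, Int.floor_eq_iff]
    have := hval α hα
    simp only [Int.cast_zero, zero_add]
    exact ⟨this.1.le, this.2⟩
  refine forall_congr' fun α => forall_congr' fun hα => ?_
  rw [hlev α hα]
  simp

theorem IsSimpleAt.apply (hP : IsEuclidean P) [P.IsCrystallographic] {u : Equiv.Perm V}
    (hu : u ∈ affineWeylGroup P) {x : V} {p q : ι × ℤ} (hp : IsSimpleAt P x p)
    (hq : ∀ y, affineRoot P q (u y) = affineRoot P p y)
    (hq' : u * wallReflection P p * u⁻¹ = wallReflection P q) : IsSimpleAt P (u x) q := by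
  refine ⟨by rw [hq]; exact hp.1, fun f hf hf' => ?_⟩
  obtain ⟨f₀, h₀, -⟩ := exists_affineRoot_conj hP (inv_mem hu) f
  have e : ∀ y, affineRoot P f₀ y = affineRoot P f (u y) := fun y => by
    rw [← h₀, ← Equiv.Perm.mul_apply, inv_mul_cancel]; rfl
  have h1 : f₀ = p := by
    refine hp.2 f₀ (by rwa [e]) ?_
    rw [e]
    rw [← hq'] at hf'
    simpa using hf'
  apply affineRoot_injective (P := P)
  ext y
  obtain ⟨y, rfl⟩ := u.surjective y
  rw [hq, ← e, h1]

/-- Some `u` in the affine Weyl group carries the alcove of `x` to the fundamental alcove and the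
simple affine roots at `x` to walls of it; conjugate back by `u⁻¹`. -/
theorem isParabolic_closure [Finite ι] [FiniteDimensional ℝ V] (hP : IsEuclidean P)
    [P.IsCrystallographic] [P.IsReduced] (b : P.Base) {x : V} (hx : x ∉ affineArrangement P)
    {M : Set (ι × ℤ)} (hM : ∀ p ∈ M, IsSimpleAt P x p) :
    IsParabolic b (Subgroup.closure (wallReflection P '' M)) := by
  obtain ⟨z, hz, hzA⟩ := exists_cell_eq_fundamentalAlcove b
  obtain ⟨u, hu, huz⟩ := exists_apply_mem_cell hP hx hz
  have hux := apply_notMem_affineArrangement hP hu hx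
  have hcell : cell P (u x) = fundamentalAlcove b := by
    rw [← hzA]
    exact (cell_congr (level_eq_of_mem_cell hux huz)).symm
  choose f hf hf' using exists_affineRoot_conj hP hu
  refine ⟨u⁻¹, inv_mem hu, (fun p => wallReflection P (f p)) '' M, ?_, ?_⟩
  · rintro _ ⟨p, hp, rfl⟩
    refine ⟨(f p).1, (f p).2, ?_, rfl⟩
    rw [← hcell]
    exact ((hM p hp).apply hP hu (hf p) (hf' p)).isWall hP hux
  · rw [Set.image_image]
    congr 1
    refine Set.image_congr fun p _ => ?_
    rw [← hf']
    group

/-! ### Irreducible roots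

A vector `v` orthogonal to no root determines the positive system of the roots `α` with
`0 < ⟨v, α⟩`. -/

/-- The positive root `α` is irreducible at `x`: its level is not the sum of the levels of two
positive roots with sum `α`. -/
def IsIrreducibleAt (P : RootPairing ι ℝ V N) (v x : V) (α : ι) : Prop :=
  0 < ⟪v, P.root α⟫_ℝ ∧ ∀ β γ, 0 < ⟪v, P.root β⟫_ℝ → 0 < ⟪v, P.root γ⟫_ℝ →
    P.root α = P.root β + P.root γ → level P x α ≠ level P x β + level P x γ

/-- Choose the carry `β = α + γ` with `γ` lowest. A level-additive splitting of `β` would yield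
either a carry with a lower summand or a level-additive splitting of `α`. -/
theorem exists_isIrreducibleAt_add [Finite ι] (hP : IsEuclidean P) [P.IsCrystallographic] {v : V}
    (hv : ∀ α, ⟪v, P.root α⟫_ℝ ≠ 0) {x : V} {α : ι} (hα : IsIrreducibleAt P v x α)
    (h : ∃ γ β, 0 < ⟪v, P.root γ⟫_ℝ ∧ P.root β = P.root α + P.root γ ∧
      level P x β = level P x α + level P x γ + 1) :
    ∃ γ β, 0 < ⟪v, P.root γ⟫_ℝ ∧ P.root β = P.root α + P.root γ ∧
      level P x β = level P x α + level P x γ + 1 ∧ IsIrreducibleAt P v x β := by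
  obtain ⟨γ, ⟨β, hγ, hβ, hlev⟩, hmin⟩ := (Set.toFinite {γ | ∃ β, 0 < ⟪v, P.root γ⟫_ℝ ∧
    P.root β = P.root α + P.root γ ∧ level P x β = level P x α + level P x γ + 1}).exists_minimalFor
    (fun γ => ⟪v, P.root γ⟫_ℝ) _ h
  refine ⟨γ, β, hγ, hβ, hlev, by rw [hβ, inner_add_right]; exact add_pos hα.1 hγ, ?_⟩
  have aux : ∀ δ ε, 0 < ⟪v, P.root δ⟫_ℝ → 0 < ⟪v, P.root ε⟫_ℝ → P.root β = P.root δ + P.root ε →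
      level P x β = level P x δ + level P x ε →
      (α = δ ∨ ∃ η, P.root η = P.root α - P.root δ) → False := by
    rintro δ ε hδ hε e hl (rfl | ⟨η, hη⟩)
    · have : γ = ε := P.root.injective (by rw [hβ] at e; exact add_left_cancel e)
      subst this
      omega
    -- If `δ - α` is positive, it is a lower summand of a carry from `α`. If `α - δ` is positive,
    -- comparing levels in `ε = γ + η` makes `α = δ + η` level-additive.
    · rcases lt_or_gt_of_ne (hv η) with hneg | hpos
      · set θ := P.reflectionPerm η η with hθ
        have hθr : P.root θ = P.root δ - P.root α := by rw [hθ, root_negIndex, hη]; abel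
        have hθpos : 0 < ⟪v, P.root θ⟫_ℝ := by rw [root_negIndex, inner_neg_right]; linarith
        have e1 : P.root δ = P.root α + P.root θ := by rw [hθr]; abel
        have e2 : P.root γ = P.root ε + P.root θ := by
          rw [hθr]; rw [hβ] at e
          rw [← add_sub_assoc, add_comm, ← e]; abel
        have l1 := level_le_add (x := x) e1
        have l2 := level_add_le (x := x) e2
        have hlt : ⟪v, P.root θ⟫_ℝ < ⟪v, P.root γ⟫_ℝ := by
          rw [e2, inner_add_right]; linarith
        exact hlt.not_ge (hmin ⟨δ, hθpos, e1, by omega⟩ hlt.le)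
      · have e1 : P.root α = P.root δ + P.root η := by rw [hη]; abel
        have e2 : P.root ε = P.root γ + P.root η := by
          rw [hβ] at e
          rw [hη, ← add_sub_assoc, add_comm, e]; abel
        have l1 := level_le_add (x := x) e1
        have l2 := level_le_add (x := x) e2
        have l3 := hα.2 δ η hδ hpos e1
        have l4 := level_add_le (x := x) e1
        omega
  intro δ ε hδ hε e hl
  have hpos := inner_root_self_pos (P := P) β
  -- The squared norm of `β` is the sum of the four products of `α`, `γ` with `δ`, `ε`, so one is
  -- positive and gives an equality or a root difference.
  have hsum : ⟪P.root β, P.root β⟫_ℝ = ⟪P.root α, P.root δ⟫_ℝ + ⟪P.root α, P.root ε⟫_ℝ +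
      (⟪P.root γ, P.root δ⟫_ℝ + ⟪P.root γ, P.root ε⟫_ℝ) := by
    conv_lhs => rw [hβ]
    rw [← hβ, e, inner_add_right, ← e, hβ, inner_add_left, inner_add_left]
    ring
  have swap : P.root α - P.root δ = -(P.root γ - P.root ε) := by
    rw [hβ] at e
    rw [eq_neg_iff_add_eq_zero, sub_add_sub_comm, e, sub_self]
  have swap' : P.root α - P.root ε = -(P.root γ - P.root δ) := by
    rw [hβ, add_comm (P.root δ)] at e
    rw [eq_neg_iff_add_eq_zero, sub_add_sub_comm, e, sub_self]
  have direct : ∀ δ, 0 < ⟪P.root α, P.root δ⟫_ℝ →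
      α = δ ∨ ∃ η, P.root η = P.root α - P.root δ := fun δ h =>
    or_iff_not_imp_left.mpr fun hne => exists_root_eq_sub hP h hne
  have indirect : ∀ δ ε, P.root α - P.root δ = -(P.root γ - P.root ε) →
      0 < ⟪P.root γ, P.root ε⟫_ℝ → α = δ ∨ ∃ η, P.root η = P.root α - P.root δ := by
    intro δ ε hs h
    by_cases hne : γ = ε
    · left
      rw [hne, sub_self, neg_zero, sub_eq_zero] at hs
      exact P.root.injective hs
    · obtain ⟨η, hη⟩ := exists_root_eq_sub hP h hne
      exact Or.inr ⟨P.reflectionPerm η η, by rw [root_negIndex, hη, hs]⟩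
  have e' : P.root β = P.root ε + P.root δ := by rw [e, add_comm]
  have hl' : level P x β = level P x ε + level P x δ := by rw [hl, add_comm]
  by_cases c1 : 0 < ⟪P.root α, P.root δ⟫_ℝ
  · exact aux δ ε hδ hε e hl (direct δ c1)
  by_cases c2 : 0 < ⟪P.root α, P.root ε⟫_ℝ
  · exact aux ε δ hε hδ e' hl' (direct ε c2)
  by_cases c3 : 0 < ⟪P.root γ, P.root δ⟫_ℝ
  · exact aux ε δ hε hδ e' hl' (indirect ε δ swap' c3)
  by_cases c4 : 0 < ⟪P.root γ, P.root ε⟫_ℝ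
  · exact aux δ ε hδ hε e hl (indirect δ ε swap c4)
  linarith

/-- A level-additive splitting with a negative summand is, after moving that summand across, a
carry: negating a root turns its level `n` into `-n - 1`. -/
theorem IsIrreducibleAt.isSimpleAt [Finite ι] (hP : IsEuclidean P) [P.IsCrystallographic]
    [P.IsReduced] {v : V} (hv : ∀ α, ⟪v, P.root α⟫_ℝ ≠ 0) {x : V} (hx : x ∉ affineArrangement P)
    {α : ι} (hα : IsIrreducibleAt P v x α)
    (h : ¬ ∃ γ β, 0 < ⟪v, P.root γ⟫_ℝ ∧ P.root β = P.root α + P.root γ ∧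
      level P x β = level P x α + level P x γ + 1) :
    IsSimpleAt P x (α, level P x α) := by
  have aux : ∀ β γ, ⟪v, P.root γ⟫_ℝ < 0 → P.root α = P.root β + P.root γ →
      level P x α = level P x β + level P x γ → False := by
    intro β γ hγ e hl
    refine h ⟨P.reflectionPerm γ γ, β, ?_, ?_, ?_⟩
    · rw [root_negIndex, inner_neg_right]; linarith
    · rw [root_negIndex, e]; abel
    · rw [level_neg hx]; omega
  refine isSimpleAt_of_indecomposable hP hx fun β γ e hl => ?_
  rcases lt_or_gt_of_ne (hv γ) with hγ | hγ
  · exact aux β γ hγ e hl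
  rcases lt_or_gt_of_ne (hv β) with hβ | hβ
  · exact aux γ β hβ (by rw [e, add_comm]) (by rw [hl, add_comm])
  exact hα.2 β γ hβ hγ e hl

/-- In a set `T` of points cut out by hyperplanes of `𝓗`, a generic point with the lowest levels
has all its irreducible roots in `𝓗`. -/
theorem exists_forall_isIrreducibleAt_mem [Finite ι] (hP : IsEuclidean P) [P.IsCrystallographic]
    [P.IsReduced] {v : V} (hv : ∀ α, ⟪v, P.root α⟫_ℝ ≠ 0) {T : Set V} {𝓗 : Set (ι × ℤ)}
    (hne : ∃ x ∈ T, x ∉ affineArrangement P) (C : ι → ℤ)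
    (hC : ∀ x ∈ T, ∀ α, 0 < ⟪v, P.root α⟫_ℝ → C α ≤ level P x α)
    (hT : ∀ x ∈ T, x ∉ affineArrangement P → ∀ α, (α, level P x α) ∉ 𝓗 →
      IsSimpleAt P x (α, level P x α) → wallReflection P (α, level P x α) x ∈ T)
    (hadd : ∀ x ∈ T, x ∉ affineArrangement P → ∀ α β γ, 0 < ⟪v, P.root α⟫_ℝ →
      0 < ⟪v, P.root γ⟫_ℝ → P.root β = P.root α + P.root γ →
      level P x β = level P x α + level P x γ + 1 → (α, level P x α) ∉ 𝓗 →
      (β, level P x β) ∉ 𝓗) :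
    ∃ x ∈ T, x ∉ affineArrangement P ∧
      ∀ α, IsIrreducibleAt P v x α → (α, level P x α) ∈ 𝓗 := by
  classical
  have := Fintype.ofFinite ι
  let n : V → ℕ := fun x => ∑ α with 0 < ⟪v, P.root α⟫_ℝ, (level P x α - C α).toNat
  obtain ⟨x, ⟨hxT, hx⟩, hmin⟩ := WellFounded.has_min (measure n).wf
    {x | x ∈ T ∧ x ∉ affineArrangement P} hne
  refine ⟨x, hxT, hx, ?_⟩
  by_contra! hcon
  -- A carry from a highest bad root could be chosen with irreducible sum, a higher bad root. So
  -- this root is simple, and reflecting in it lowers only its own level among the roots summed in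
  -- `n`.
  obtain ⟨α, ⟨hα, hα𝓗⟩, hmax⟩ := (Set.toFinite {α | IsIrreducibleAt P v x α ∧
    (α, level P x α) ∉ 𝓗}).exists_maximalFor (fun α => ⟪v, P.root α⟫_ℝ) _ hcon
  have hsimple : IsSimpleAt P x (α, level P x α) := by
    refine hα.isSimpleAt hP hv hx fun h => ?_
    obtain ⟨γ, β, hγ, e, hl, hβ⟩ := exists_isIrreducibleAt_add hP hv hα h
    have hlt : ⟪v, P.root α⟫_ℝ < ⟪v, P.root β⟫_ℝ := by rw [e, inner_add_right]; linarith
    exact hlt.not_ge (hmax ⟨hβ, hadd x hxT hx α β γ hα.1 hγ e hl hα𝓗⟩ hlt.le)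
  have hyT := hT x hxT hx α hα𝓗 hsimple
  have hy := apply_notMem_affineArrangement hP
    (wallReflection_mem_affineWeylGroup (P := P) (α, level P x α)) hx
  have hself := hsimple.level_wallReflection_self hP
  refine hmin _ ⟨hyT, hy⟩ ?_
  change n _ < n _
  have hmem : α ∈ Finset.univ.filter fun α => 0 < ⟪v, P.root α⟫_ℝ := by simpa using hα.1
  refine Finset.sum_lt_sum (fun β hβ => ?_) ⟨α, hmem, ?_⟩
  · by_cases h1 : β = α
    · rw [h1, hself]; omega
    · rw [hsimple.level_wallReflection_of_ne hP hx h1]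
      rintro rfl
      have h2 := (Finset.mem_filter.mp hβ).2
      rw [root_negIndex, inner_neg_right] at h2
      linarith [hα.1]
  · have := hC _ hyT α hα.1
    rw [hself] at this ⊢
    omega

theorem catalanRoots_finite [Finite ι] (k : ℕ) : (catalanRoots ι k).Finite := by
  refine (Set.finite_univ.prod (Set.finite_Icc (-(k : ℤ)) k)).subset fun p hp => ?_
  exact ⟨trivial, abs_le.mp hp⟩

/-- A short segment in a direction orthogonal to no root stays in the region and meets only
countably many hyperplanes, each in one point. -/
theorem IsRegion.exists_generic [Finite ι] {v : V} (hv : ∀ α, ⟪v, P.root α⟫_ℝ ≠ 0) {k : ℕ}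
    {R : Set V} (hR : IsRegion P k R) : ∃ x ∈ R, x ∉ affineArrangement P := by
  obtain ⟨z, hz⟩ : ∃ z, z ∈ R := by
    obtain ⟨z, hz, rfl⟩ := hR
    exact ⟨z, mem_connectedComponentIn hz⟩
  have hline : ∀ (p : ι × ℤ) (t : ℝ), affineRoot P p (z + t • v) =
      affineRoot P p z + t * ⟪v, P.root p.1⟫_ℝ := by
    intro p t
    simp only [affineRoot, inner_add_left, real_inner_smul_left]
    ring
  have hopen : ∀ᶠ t : ℝ in nhds 0, z + t • v ∈ R := by
    rw [hR.eq_sideSet hz]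
    simp only [sideSet, Set.mem_ofPred_eq]
    rw [Filter.eventually_all_finite (catalanRoots_finite k)]
    intro p hp
    by_cases hpz : 0 < affineRoot P p z
    · have hcont : Continuous fun t : ℝ => affineRoot P p (z + t • v) :=
        (continuous_affineRoot p).comp (by fun_prop)
      have h0 := hcont.tendsto 0
      rw [zero_smul, add_zero] at h0
      filter_upwards [h0.eventually (lt_mem_nhds hpz)] with t ht _
      exact ht
    · exact Filter.Eventually.of_forall fun t h => absurd h hpz
  have hcount : (⋃ p : ι × ℤ, {-affineRoot P p z / ⟪v, P.root p.1⟫_ℝ}).Countable :=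
    Set.countable_iUnion fun p => Set.countable_singleton _
  obtain ⟨t, ht, ht'⟩ := (hcount.dense_compl ℝ).inter_nhds_nonempty hopen
  refine ⟨z + t • v, ht', notMem_affineArrangement_iff.mpr fun p h0 => ht ?_⟩
  refine Set.mem_iUnion.mpr ⟨p, ?_⟩
  rw [hline] at h0
  rw [Set.mem_singleton_iff, eq_div_iff (hv p.1)]
  linarith

/-- A wall of a region is a wall of the alcove of a suitable generic point of the region. -/
theorem IsWall.isSimpleAt [Finite ι] (hP : IsEuclidean P) [P.IsCrystallographic]
    [P.IsReduced] {v : V} (hv : ∀ α, ⟪v, P.root α⟫_ℝ ≠ 0) {k : ℕ} {R : Set V}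
    (hR : IsRegion P k R) {x : V} (hxR : x ∈ R) (hx : x ∉ affineArrangement P)
    {𝓗 : Set (ι × ℤ)} (h𝓗 : ∀ α, IsIrreducibleAt P v x α → (α, level P x α) ∈ 𝓗) {α : ι}
    (hα : 0 < ⟪v, P.root α⟫_ℝ) (hwall : IsWall P R α (level P x α))
    (hsub : ∀ β γ, 0 < ⟪v, P.root β⟫_ℝ → 0 < ⟪v, P.root γ⟫_ℝ →
      P.root α = P.root β + P.root γ → level P x α = level P x β + level P x γ →
      |level P x β| ≤ k)
    (hadd : ∀ β γ, 0 < ⟪v, P.root γ⟫_ℝ → P.root β = P.root α + P.root γ →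
      level P x β = level P x α + level P x γ + 1 → (β, level P x β) ∈ 𝓗 →
      |level P x β| ≤ k ∧ |level P x γ + 1| ≤ k) :
    IsSimpleAt P x (α, level P x α) := by
  have hpos : ∀ p : ι × ℤ, |p.2| ≤ k → 0 < affineRoot P p x → ∀ y ∈ R, 0 < affineRoot P p y := by
    intro p hp hpx y hy
    rw [hR.eq_sideSet hxR] at hy
    exact hy p hp hpx
  -- The parts of a level-additive splitting have offsets within the Catalan range, hence are
  -- positive on all of `R`; a wall admits no such splitting.
  have hirr : IsIrreducibleAt P v x α := by
    refine ⟨hα, fun β γ hβ hγ e hl => ?_⟩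
    refine IsWall.not_decomposable (p := (α, level P x α)) (q := (β, level P x β))
      (r := (γ, level P x γ)) hwall ?_ ?_ (affineRoot_add e hl)
    · exact hpos _ (hsub β γ hβ hγ e hl) (affineRoot_level_pos hx β)
    · exact hpos _ (hsub γ β hγ hβ (by rw [e, add_comm]) (by rw [hl, add_comm]))
        (affineRoot_level_pos hx γ)
  refine hirr.isSimpleAt hP hv hx fun h => ?_
  obtain ⟨γ, β, hγ, e, hl, hβ⟩ := exists_isIrreducibleAt_add hP hv hirr h
  -- A carry with irreducible sum writes the wall's affine root as that of `β` plus that of `-γ`,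
  -- again both positive on `R`.
  obtain ⟨h1, h2⟩ := hadd β γ hγ e hl (h𝓗 β hβ)
  refine IsWall.not_decomposable (p := (α, level P x α)) (q := (β, level P x β))
    (r := (P.reflectionPerm γ γ, level P x (P.reflectionPerm γ γ))) hwall ?_ ?_
    (affineRoot_add (by rw [root_negIndex, e]; abel) (by rw [level_neg hx]; omega))
  · exact hpos _ h1 (affineRoot_level_pos hx β)
  · refine hpos _ ?_ (affineRoot_level_pos hx _)
    simp only [level_neg hx]
    rw [← abs_neg]
    convert h2 using 2
    ring

theorem IsWall.exists_mem_closure {R : Set V} {α : ι} {r : ℤ} (h : IsWall P R α r) :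
    ∃ y ∈ closure R, ⟪y, P.root α⟫_ℝ = r := by
  by_contra! hcon
  have hempty : closure R ∩ hyperplane P α r = ∅ :=
    Set.eq_empty_of_forall_notMem fun y hy => hcon y hy.1 hy.2
  have h2 := h.2
  rw [hempty, AffineSubspace.span_empty, AffineSubspace.bot_coe] at h2
  have h0 := (inner_root_self_pos (P := P) α).ne'
  have hmem : ((r : ℝ) / ⟪P.root α, P.root α⟫_ℝ) • P.root α ∈ hyperplane P α r := by
    simp only [hyperplane, Set.mem_ofPred_eq, real_inner_smul_left]
    field_simp
  rw [← h2] at hmem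
  exact hmem

/-! ### The minimal alcove of a dominant region -/

theorem isPos_iff_inner_pos {b : P.Base} {v : V} (hv : ∀ α, ⟪v, P.root α⟫_ℝ = b.height α)
    {α : ι} : b.IsPos α ↔ 0 < ⟪v, P.root α⟫_ℝ := by
  rw [hv, RootPairing.Base.isPos_iff]
  exact_mod_cast Iff.rfl

theorem inner_ne_zero_of_eq_height {b : P.Base} {v : V}
    (hv : ∀ α, ⟪v, P.root α⟫_ℝ = b.height α) (α : ι) : ⟪v, P.root α⟫_ℝ ≠ 0 := by
  rw [hv]
  exact_mod_cast b.height_ne_zero α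

theorem IsDominantRegion.level_nonneg {b : P.Base} {k : ℕ} {R : Set V}
    (hR : IsDominantRegion b k R) {x : V} (hx : x ∈ R) {α : ι} (hα : b.IsPos α) :
    0 ≤ level P x α :=
  Int.floor_nonneg.mpr (hR.2 α hα x hx).le

theorem IsRegion.wallReflection_mem {k : ℕ} {R : Set V} (hR : IsRegion P k R)
    (hP : IsEuclidean P) [P.IsCrystallographic] {x : V} (hxR : x ∈ R)
    (hx : x ∉ affineArrangement P) {p : ι × ℤ} (hp : IsSimpleAt P x p)
    (hpk : p ∉ catalanRoots ι k) : wallReflection P p x ∈ R := by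
  rw [hR.eq_sideSet hxR]
  intro q hq hqx
  have hy := apply_notMem_affineArrangement hP (wallReflection_mem_affineWeylGroup (P := P) p) hx
  exact affineRoot_pos_of_not_neg hy fun h => hpk (hp.2 q hqx h ▸ hq)

theorem IsRegion.affineRoot_pos {k : ℕ} {R : Set V} (hR : IsRegion P k R) {x y : V} (hx : x ∈ R)
    (hy : y ∈ R) {p : ι × ℤ} (hp : |p.2| ≤ k) (h : 0 < affineRoot P p x) :
    0 < affineRoot P p y := by
  rw [hR.eq_sideSet hx] at hy
  exact hy p hp h

theorem decompositionWeights_append {k : ℕ} {K : ℕ → Set ι} {α β γ : ι} {m n : ℕ}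
    (h : P.root α = P.root β + P.root γ) (hm : m ∈ decompositionWeights P k K β)
    (hn : n ∈ decompositionWeights P k K γ) : m + n ∈ decompositionWeights P k K α := by
  obtain ⟨l, hl, e, s⟩ := hm
  obtain ⟨l', hl', e', s'⟩ := hn
  refine ⟨l ++ l', fun p hp => ?_, by simp [e, e', h], by simp [s, s']⟩
  rcases List.mem_append.mp hp with hp | hp
  exacts [hl p hp, hl' p hp]

theorem mem_decompositionWeights_of_mem {k : ℕ} {K : ℕ → Set ι} {α : ι} {n : ℕ} (hn : n ≤ k)
    (h : α ∈ K n) : n ∈ decompositionWeights P k K α :=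
  ⟨[(α, n)], by simpa using ⟨hn, h⟩, by simp, by simp⟩

theorem le_inner_of_mem_decompositionWeights {k : ℕ} {K : ℕ → Set ι} {y : V}
    (hK : ∀ n ≤ k, ∀ β ∈ K n, (n : ℝ) ≤ ⟪y, P.root β⟫_ℝ) {α : ι} {n : ℕ}
    (hn : n ∈ decompositionWeights P k K α) : (n : ℝ) ≤ ⟪y, P.root α⟫_ℝ := by
  obtain ⟨l, hl, e, rfl⟩ := hn
  rw [← e]
  clear e
  induction l with
  | nil => simp
  | cons p l ih =>
    have h1 := hl p List.mem_cons_self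
    have h2 := hK _ h1.1 _ h1.2
    have h3 := ih fun q hq => hl q (List.mem_cons_of_mem _ hq)
    simp only [List.map_cons, List.sum_cons, inner_add_right]
    push_cast at h3 ⊢
    linarith

theorem inner_le_of_mem_decompositionWeights {k : ℕ} {K : ℕ → Set ι} {y : V}
    (hK : ∀ n ≤ k, ∀ β ∈ K n, ⟪y, P.root β⟫_ℝ ≤ n) {α : ι} {n : ℕ}
    (hn : n ∈ decompositionWeights P k K α) : ⟪y, P.root α⟫_ℝ ≤ n := by
  obtain ⟨l, hl, e, rfl⟩ := hn
  rw [← e]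
  clear e
  induction l with
  | nil => simp
  | cons p l ih =>
    have h1 := hl p List.mem_cons_self
    have h2 := hK _ h1.1 _ h1.2
    have h3 := ih fun q hq => hl q (List.mem_cons_of_mem _ hq)
    simp only [List.map_cons, List.sum_cons, inner_add_right]
    push_cast at h3 ⊢
    linarith

/-- A generic point of lowest levels in a dominant region. -/
theorem IsDominantRegion.exists_lowest [Finite ι] (hP : IsEuclidean P) [P.IsCrystallographic]
    [P.IsReduced] {b : P.Base} {v : V} (hv : ∀ α, ⟪v, P.root α⟫_ℝ = b.height α) {k : ℕ}
    {R : Set V} (hR : IsDominantRegion b k R) :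
    ∃ x ∈ R, x ∉ affineArrangement P ∧
      ∀ α, IsIrreducibleAt P v x α → (α, level P x α) ∈ catalanRoots ι k := by
  have hv0 := inner_ne_zero_of_eq_height hv
  refine exists_forall_isIrreducibleAt_mem hP hv0 (hR.1.exists_generic hv0) 0 ?_ ?_ ?_
  · exact fun x hx α hα => hR.level_nonneg hx ((isPos_iff_inner_pos hv).mpr hα)
  · exact fun x hxR hx α hα hs => hR.1.wallReflection_mem hP hxR hx hs hα
  · intro x hxR hx α β γ hα hγ e hl h1 h2
    have h3 := hR.level_nonneg hxR ((isPos_iff_inner_pos hv).mpr hα)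
    have h4 := hR.level_nonneg hxR ((isPos_iff_inner_pos hv).mpr hγ)
    simp only [catalanRoots, Set.mem_ofPred_eq] at h1 h2
    rw [abs_le] at h1 h2
    omega

section Lowest

variable {b : P.Base} {v : V} {k : ℕ} {R : Set V} {x : V}

/-- Induction on height: an irreducible root has level at most `k` and lies in the filter of that
index; any other root splits with additive levels. -/
theorem exists_mem_decompositionWeights_filterChain
    (hv : ∀ α, ⟪v, P.root α⟫_ℝ = b.height α) (hR : IsDominantRegion b k R) (hxR : x ∈ R)
    (hx : x ∉ affineArrangement P)
    (hirr : ∀ α, IsIrreducibleAt P v x α → (α, level P x α) ∈ catalanRoots ι k) {α : ι}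
    (hα : b.IsPos α) :
    ∃ n ∈ decompositionWeights P k (filterChain b R) α, (n : ℤ) = level P x α := by
  obtain ⟨m, hm⟩ : ∃ m : ℕ, b.height α ≤ m := ⟨(b.height α).toNat, Int.self_le_toNat _⟩
  induction m generalizing α with
  | zero =>
    rw [RootPairing.Base.isPos_iff] at hα
    simp at hm
    omega
  | succ m ih =>
    by_cases h : IsIrreducibleAt P v x α
    · have h1 := hirr α h
      obtain ⟨n, hn⟩ := Int.eq_ofNat_of_zero_le (hR.level_nonneg hxR hα)
      rw [hn] at h1
      simp only [catalanRoots, Set.mem_ofPred_eq, Nat.abs_cast, Nat.cast_le] at h1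
      refine ⟨n, mem_decompositionWeights_of_mem h1 ⟨hα, fun y hy => ?_⟩, hn.symm⟩
      have h2 := affineRoot_level_pos hx α
      rw [hn] at h2
      have h3 := hR.1.affineRoot_pos hxR hy (p := (α, (n : ℤ))) (by simpa using h1) h2
      simpa [affineRoot] using h3
    · have hα' := (isPos_iff_inner_pos hv).mp hα
      simp only [IsIrreducibleAt, hα', true_and] at h
      push Not at h
      obtain ⟨β, γ, hβ, hγ, e, hl⟩ := h
      rw [← isPos_iff_inner_pos hv] at hβ hγ
      have hh := b.height_add e
      have hβ' : 0 < b.height β := hβ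
      have hγ' : 0 < b.height γ := hγ
      push_cast at hm
      obtain ⟨n₁, h₁, e₁⟩ := ih hβ (by omega)
      obtain ⟨n₂, h₂, e₂⟩ := ih hγ (by omega)
      exact ⟨n₁ + n₂, decompositionWeights_append e h₁ h₂, by push_cast; omega⟩

theorem le_inner_of_mem_decompositionWeights_filterChain {y : V} (hy : y ∈ R) {α : ι} {n : ℕ}
    (hn : n ∈ decompositionWeights P k (filterChain b R) α) : (n : ℝ) ≤ ⟪y, P.root α⟫_ℝ :=
  le_inner_of_mem_decompositionWeights (fun _ _ _ hβ => (hβ.2 y hy).le) hn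

/-- Every weight is a lower bound for `⟪x, α⟫`, hence for its floor, and the level itself is
attained. -/
theorem filterWeight_eq_level (hv : ∀ α, ⟪v, P.root α⟫_ℝ = b.height α)
    (hR : IsDominantRegion b k R) (hxR : x ∈ R) (hx : x ∉ affineArrangement P)
    (hirr : ∀ α, IsIrreducibleAt P v x α → (α, level P x α) ∈ catalanRoots ι k) {α : ι}
    (hα : b.IsPos α) : (filterWeight P k (filterChain b R) α : ℤ) = level P x α := by
  obtain ⟨n, hn, e⟩ := exists_mem_decompositionWeights_filterChain hv hR hxR hx hirr hα
  have : IsGreatest (decompositionWeights P k (filterChain b R) α) n := by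
    refine ⟨hn, fun m hm => ?_⟩
    have h1 := le_inner_of_mem_decompositionWeights_filterChain hxR hm
    have h2 : (m : ℤ) ≤ level P x α := Int.le_floor.mpr (by simpa using h1)
    omega
  rw [filterWeight, this.csSup_eq, e]

theorem minimalAlcove_eq_cell (hv : ∀ α, ⟪v, P.root α⟫_ℝ = b.height α)
    (hR : IsDominantRegion b k R) (hxR : x ∈ R) (hx : x ∉ affineArrangement P)
    (hirr : ∀ α, IsIrreducibleAt P v x α → (α, level P x α) ∈ catalanRoots ι k) :
    minimalAlcove b k R = cell P x := by
  ext y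
  rw [mem_cell_iff_of_isPos b hx]
  refine forall_congr' fun α => forall_congr' fun hα => ?_
  have : (filterWeight P k (filterChain b R) α : ℝ) = level P x α := by
    exact_mod_cast filterWeight_eq_level hv hR hxR hx hirr hα
  rw [this]

/-- The floors of a dominant region are walls of its minimal alcove. -/
theorem IsFloor.isSimpleAt [Finite ι] (hP : IsEuclidean P) [P.IsCrystallographic]
    [P.IsReduced] (hv : ∀ α, ⟪v, P.root α⟫_ℝ = b.height α)
    (hR : IsDominantRegion b k R) (hxR : x ∈ R) (hx : x ∉ affineArrangement P)
    (hirr : ∀ α, IsIrreducibleAt P v x α → (α, level P x α) ∈ catalanRoots ι k) {α : ι} {r : ℕ}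
    (hα : b.IsPos α) (hr : r ≤ k) (h : IsFloor P R α r) : IsSimpleAt P x (α, (r : ℤ)) := by
  have hlev : level P x α = r := by
    apply le_antisymm
    -- The level is a weight, hence a lower bound for `α` on the closure of `R`, which meets the
    -- floor at height `r`.
    · by_contra! hlt
      obtain ⟨n, hn, e⟩ := exists_mem_decompositionWeights_filterChain hv hR hxR hx hirr hα
      obtain ⟨y, hy, hyr⟩ := h.2.1.exists_mem_closure
      have h1 : (n : ℝ) ≤ ⟪y, P.root α⟫_ℝ :=
        closure_minimal (s := R) (t := {y | (n : ℝ) ≤ ⟪y, P.root α⟫_ℝ})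
          (fun y hy => le_inner_of_mem_decompositionWeights_filterChain hy hn)
          (isClosed_le continuous_const (by fun_prop)) hy
      rw [hyr] at h1
      have h2 : (n : ℤ) ≤ r := by exact_mod_cast h1
      omega
    · exact Int.le_floor.mpr (by simpa using (h.2.2 x hxR).le)
  rw [← hlev]
  have hnn : ∀ {β}, 0 < ⟪v, P.root β⟫_ℝ → 0 ≤ level P x β := fun hβ =>
    hR.level_nonneg hxR ((isPos_iff_inner_pos hv).mpr hβ)
  refine IsWall.isSimpleAt hP (inner_ne_zero_of_eq_height hv) hR.1 hxR hx hirr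
    ((isPos_iff_inner_pos hv).mp hα) (by rw [hlev]; exact h.2.1) ?_ ?_
  · intro β γ hβ hγ e hl
    have h1 := hnn hβ
    have h2 := hnn hγ
    rw [abs_le]
    omega
  · intro β γ hγ e hl hβ
    have h2 := hnn hγ
    simp only [catalanRoots, Set.mem_ofPred_eq] at hβ
    refine ⟨hβ, ?_⟩
    rw [abs_le] at hβ ⊢
    omega

end Lowest

/-! ### The pseudomaximal alcove of a dominant region -/

/-- The affine roots that bound the part of a region where the simple roots take values less than
`k + 1`. -/
def truncatedRoots (b : P.Base) (k : ℕ) : Set (ι × ℤ) :=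
  catalanRoots ι k ∪ {p | ∃ σ ∈ b.support, p = negRoot P (σ, (k + 1 : ℤ))}

theorem height_negIndex (b : P.Base) (α : ι) : b.height (P.reflectionPerm α α) = -b.height α :=
  b.height_reflectionPerm_self α

theorem inner_neg_pos_iff {b : P.Base} {v : V} (hv : ∀ α, ⟪v, P.root α⟫_ℝ = b.height α) {α : ι} :
    0 < ⟪-v, P.root α⟫_ℝ ↔ b.height α < 0 := by
  rw [inner_neg_left, hv, Left.neg_pos_iff]
  exact_mod_cast Iff.rfl

theorem inner_neg_ne_zero {b : P.Base} {v : V} (hv : ∀ α, ⟪v, P.root α⟫_ℝ = b.height α) (α : ι) :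
    ⟪-v, P.root α⟫_ℝ ≠ 0 := by
  rw [inner_neg_left]
  exact neg_ne_zero.mpr (inner_ne_zero_of_eq_height hv α)

theorem inner_le_mul_height [Finite ι] [P.IsCrystallographic] {b : P.Base} {y : V} {c : ℝ}
    (hy : ∀ σ ∈ b.support, ⟪y, P.root σ⟫_ℝ ≤ c) {α : ι} (hα : b.IsPos α) :
    ⟪y, P.root α⟫_ℝ ≤ c * b.height α := by
  refine hα.induction_on_add (p := fun α => ⟪y, P.root α⟫_ℝ ≤ c * b.height α) ?_ ?_
  · intro σ hσ
    rw [RootPairing.Base.height_one_of_mem_support hσ]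
    simpa using hy σ hσ
  · intro i j l e hi hj
    rw [b.height_add e, RootPairing.Base.height_one_of_mem_support hj, e, inner_add_right]
    push_cast
    have := hy j hj
    linarith

theorem IsDominantRegion.level_neg_of_height_neg {b : P.Base} {k : ℕ} {R : Set V}
    (hR : IsDominantRegion b k R) {x : V} (hxR : x ∈ R) (hx : x ∉ affineArrangement P) {α : ι}
    (hα : b.height α < 0) : level P x α < 0 := by
  have h1 : b.IsPos (P.reflectionPerm α α) := by
    rw [RootPairing.Base.isPos_iff, height_negIndex]; omega
  have h2 := hR.level_nonneg hxR h1
  rw [level_neg hx] at h2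
  omega

/-- A sum of two negative roots has height at most `-2`, so it is not the negative of a simple root.
-/
theorem mem_truncatedRoots_iff_of_root_eq_add {b : P.Base} {k : ℕ} {α β γ : ι} {r : ℤ}
    (hα : b.height α < 0) (hγ : b.height γ < 0) (e : P.root β = P.root α + P.root γ) :
    (β, r) ∈ truncatedRoots b k ↔ |r| ≤ k := by
  refine ⟨?_, Or.inl⟩
  rintro (h | ⟨σ, hσ, h⟩)
  · exact h
  · exfalso
    have h1 : β = P.reflectionPerm σ σ := congrArg Prod.fst h
    have h2 := b.height_add e
    rw [h1, height_negIndex, RootPairing.Base.height_one_of_mem_support hσ] at h2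
    omega

/-- A generic point of highest levels in the part of a dominant region where the simple roots take
values less than `k + 1`. -/
theorem IsDominantRegion.exists_highest [Finite ι] (hP : IsEuclidean P) [P.IsCrystallographic]
    [P.IsReduced] {b : P.Base} {v : V} (hv : ∀ α, ⟪v, P.root α⟫_ℝ = b.height α) {k : ℕ}
    {R : Set V} (hR : IsDominantRegion b k R) :
    ∃ x ∈ R, (∀ σ ∈ b.support, ⟪x, P.root σ⟫_ℝ < k + 1) ∧ x ∉ affineArrangement P ∧
      ∀ α, IsIrreducibleAt P (-v) x α → (α, level P x α) ∈ truncatedRoots b k := by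
  suffices h : ∃ x ∈ {x | x ∈ R ∧ ∀ σ ∈ b.support, ⟪x, P.root σ⟫_ℝ < k + 1},
      x ∉ affineArrangement P ∧
      ∀ α, IsIrreducibleAt P (-v) x α → (α, level P x α) ∈ truncatedRoots b k by
    obtain ⟨x, ⟨h1, h2⟩, h3⟩ := h
    exact ⟨x, h1, h2, h3⟩
  -- For `-v` the positive roots are the negative ones, so lowest becomes highest. The truncation by
  -- simple roots supplies the level bound, as `R` itself may be unbounded.
  refine exists_forall_isIrreducibleAt_mem hP (inner_neg_ne_zero hv) ?_
    (fun α => (k + 1) * b.height α) ?_ ?_ ?_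
  · obtain ⟨x, hxR, hx, hirr⟩ := hR.exists_lowest hP hv
    refine ⟨x, ⟨hxR, fun σ hσ => ?_⟩, hx⟩
    have hσ1 := RootPairing.Base.height_one_of_mem_support hσ
    -- A simple root has no positive splitting, so its level at a lowest point is at most `k`.
    have h1 := hirr σ ⟨by rw [hv, hσ1]; simp, fun β γ hβ hγ e => by
      rw [← isPos_iff_inner_pos hv, RootPairing.Base.isPos_iff] at hβ hγ
      have := b.height_add e
      omega⟩
    simp only [catalanRoots, Set.mem_ofPred_eq] at h1
    have h2 : (level P x σ : ℝ) ≤ k := by exact_mod_cast (abs_le.mp h1).2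
    have h3 := affineRoot_level_lt_one (P := P) x σ
    simp only [affineRoot] at h3
    linarith
  · rintro x ⟨hxR, hxσ⟩ α hα
    rw [inner_neg_pos_iff hv] at hα
    have h1 : b.IsPos (P.reflectionPerm α α) := by
      rw [RootPairing.Base.isPos_iff, height_negIndex]; omega
    have h2 := inner_le_mul_height (fun σ hσ => (hxσ σ hσ).le) h1
    rw [height_negIndex, root_negIndex, inner_neg_right] at h2
    rw [level, Int.le_floor]
    push_cast at h2 ⊢
    linarith
  · rintro x ⟨hxR, hxσ⟩ hx α hα hs
    refine ⟨hR.1.wallReflection_mem hP hxR hx hs fun h => hα (Or.inl h), fun σ hσ => ?_⟩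
    have hy := apply_notMem_affineArrangement hP
      (wallReflection_mem_affineWeylGroup (P := P) (α, level P x α)) hx
    have h1 : 0 < affineRoot P (negRoot P (σ, (k + 1 : ℤ))) (wallReflection P (α, level P x α) x) := by
      refine affineRoot_pos_of_not_neg hy fun h => hα (Or.inr ⟨σ, hσ, (hs.2 _ ?_ h).symm⟩)
      rw [affineRoot_negRoot]
      have := hxσ σ hσ
      simp only [affineRoot]
      push_cast
      linarith
    rw [affineRoot_negRoot] at h1
    simp only [affineRoot] at h1
    push_cast at h1
    linarith
  · rintro x ⟨hxR, hxσ⟩ hx α β γ hα hγ e hl h1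
    rw [inner_neg_pos_iff hv] at hα hγ
    rw [mem_truncatedRoots_iff_of_root_eq_add hα hγ e]
    have h2 : ¬ |level P x α| ≤ k := fun h => h1 (Or.inl h)
    have h3 := hR.level_neg_of_height_neg hxR hx hα
    have h4 := hR.level_neg_of_height_neg hxR hx hγ
    rw [abs_le] at h2 ⊢
    omega

/-! ### Levels at a highest point as ideal weights, and ceilings -/

section Highest

variable {b : P.Base} {v : V} {k : ℕ} {R : Set V} {x : V}

theorem exists_mem_decompositionWeights_extendedIdealChain
    (hv : ∀ α, ⟪v, P.root α⟫_ℝ = b.height α) (hR : IsDominantRegion b k R) (hxR : x ∈ R)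
    (hx : x ∉ affineArrangement P)
    (hirr : ∀ α, IsIrreducibleAt P (-v) x α → (α, level P x α) ∈ truncatedRoots b k) {α : ι}
    (hα : b.IsPos α) :
    ∃ n ∈ decompositionWeights P (k + 1) (extendedIdealChain b k R) α,
      (n : ℤ) = level P x α + 1 := by
  obtain ⟨m, hm⟩ : ∃ m : ℕ, b.height α ≤ m := ⟨(b.height α).toNat, Int.self_le_toNat _⟩
  induction m generalizing α with
  | zero =>
    rw [RootPairing.Base.isPos_iff] at hα
    simp at hm
    omega
  | succ m ih =>
    have hα0 : 0 < b.height α := hα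
    have hneg : 0 < ⟪-v, P.root (P.reflectionPerm α α)⟫_ℝ := by
      rw [inner_neg_pos_iff hv, height_negIndex]; omega
    by_cases h : IsIrreducibleAt P (-v) x (P.reflectionPerm α α)
    · obtain ⟨n, hn⟩ := Int.eq_ofNat_of_zero_le (hR.level_nonneg hxR hα)
      refine ⟨n + 1, ?_, by push_cast; omega⟩
      rcases hirr _ h with h1 | ⟨σ, hσ, h1⟩
      -- An irreducible negative root with Catalan offset puts `α` in the ideal of index level plus
      -- one. The remaining case is a simple root of level exactly `k`, which lies in the ideal of
      -- index `k + 1` through `S`.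
      · simp only [catalanRoots, Set.mem_ofPred_eq, level_neg hx, abs_le] at h1
        have hnk : n + 1 ≤ k := by omega
        refine mem_decompositionWeights_of_mem (by omega) ?_
        rw [extendedIdealChain, if_pos hnk]
        refine ⟨hα, fun y hy => ?_⟩
        have h2 := affineRoot_level_pos hx (P.reflectionPerm α α)
        have h3 := hR.1.affineRoot_pos hxR hy (by
          simp only [level_neg hx, abs_le]; omega) h2
        simp only [level_neg hx, affineRoot, root_negIndex, inner_neg_right, hn] at h3
        push_cast at h3 ⊢
        linarith
      · have hασ : α = σ := by
          have h2 : P.reflectionPerm α α = P.reflectionPerm σ σ := congrArg Prod.fst h1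
          apply P.root.injective
          have := congrArg P.root h2
          rwa [root_negIndex, root_negIndex, neg_inj] at this
        have h2 : level P x (P.reflectionPerm α α) = -(k + 1 : ℤ) := congrArg Prod.snd h1
        rw [level_neg hx] at h2
        have hnk : n = k := by omega
        refine mem_decompositionWeights_of_mem (by omega) ?_
        rw [extendedIdealChain, if_neg (by omega), hασ]
        exact Or.inr hσ
    · simp only [IsIrreducibleAt, hneg, true_and] at h
      push Not at h
      obtain ⟨β, γ, hβ, hγ, e, hl⟩ := h
      rw [inner_neg_pos_iff hv] at hβ hγ
      have hh := b.height_add e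
      rw [height_negIndex] at hh
      have hβ' : b.IsPos (P.reflectionPerm β β) := by
        rw [RootPairing.Base.isPos_iff, height_negIndex]; omega
      have hγ' : b.IsPos (P.reflectionPerm γ γ) := by
        rw [RootPairing.Base.isPos_iff, height_negIndex]; omega
      push_cast at hm
      obtain ⟨n₁, h₁, e₁⟩ := ih hβ' (by rw [height_negIndex]; omega)
      obtain ⟨n₂, h₂, e₂⟩ := ih hγ' (by rw [height_negIndex]; omega)
      rw [level_neg hx] at e₁ e₂ hl
      refine ⟨n₁ + n₂, decompositionWeights_append ?_ h₁ h₂, by push_cast; omega⟩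
      rw [root_negIndex, neg_eq_iff_eq_neg] at e
      rw [e, root_negIndex, root_negIndex]
      abel

/-- The truncation is needed for the simple roots in the last ideal; its other members satisfy the
bound throughout `R`. -/
theorem inner_le_of_mem_extendedIdealChain (hxR : x ∈ R)
    (hxσ : ∀ σ ∈ b.support, ⟪x, P.root σ⟫_ℝ < k + 1) {n : ℕ} (hn : n ≤ k + 1) {β : ι}
    (hβ : β ∈ extendedIdealChain b k R n) : ⟪x, P.root β⟫_ℝ ≤ n := by
  rw [extendedIdealChain] at hβ
  split_ifs at hβ with h
  · exact (hβ.2 x hxR).le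
  · have hnk : n = k + 1 := by omega
    subst hnk
    push_cast
    rcases hβ with (⟨_, p, q, δ, ε, _, _, hpq, hδ, hε, e⟩ | hβ) | hβ
    · have h1 := hδ.2 x hxR
      have h2 := hε.2 x hxR
      have h3 : (p : ℝ) + q = k + 1 := by exact_mod_cast hpq
      rw [e, inner_add_right]
      linarith
    · have := hβ.2 x hxR
      linarith
    · exact (hxσ β hβ).le

theorem idealWeight_eq_level (hv : ∀ α, ⟪v, P.root α⟫_ℝ = b.height α)
    (hR : IsDominantRegion b k R) (hxR : x ∈ R) (hx : x ∉ affineArrangement P)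
    (hxσ : ∀ σ ∈ b.support, ⟪x, P.root σ⟫_ℝ < k + 1)
    (hirr : ∀ α, IsIrreducibleAt P (-v) x α → (α, level P x α) ∈ truncatedRoots b k) {α : ι}
    (hα : b.IsPos α) :
    (idealWeight P (k + 1) (extendedIdealChain b k R) α : ℤ) = level P x α + 1 := by
  obtain ⟨n, hn, e⟩ := exists_mem_decompositionWeights_extendedIdealChain hv hR hxR hx hirr hα
  have : IsLeast (decompositionWeights P (k + 1) (extendedIdealChain b k R) α) n := by
    refine ⟨hn, fun m hm => ?_⟩
    have h1 := inner_le_of_mem_decompositionWeights (y := x)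
      (fun n hn β hβ => inner_le_of_mem_extendedIdealChain hxR hxσ hn hβ) hm
    have h2 : level P x α < m := by
      by_contra! hle
      have := (le_level_iff hx).mp hle
      simp only [affineRoot, Int.cast_natCast] at this
      linarith
    omega
  rw [idealWeight, this.csInf_eq, e]

theorem pseudomaximalAlcove_eq_cell (hv : ∀ α, ⟪v, P.root α⟫_ℝ = b.height α)
    (hR : IsDominantRegion b k R) (hxR : x ∈ R) (hx : x ∉ affineArrangement P)
    (hxσ : ∀ σ ∈ b.support, ⟪x, P.root σ⟫_ℝ < k + 1)
    (hirr : ∀ α, IsIrreducibleAt P (-v) x α → (α, level P x α) ∈ truncatedRoots b k) :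
    pseudomaximalAlcove b k R = cell P x := by
  ext y
  rw [mem_cell_iff_of_isPos b hx]
  refine forall_congr' fun α => forall_congr' fun hα => ?_
  have : (idealWeight P (k + 1) (extendedIdealChain b k R) α : ℝ) = level P x α + 1 := by
    exact_mod_cast idealWeight_eq_level hv hR hxR hx hxσ hirr hα
  rw [this, add_sub_cancel_right]

/-- The ceilings of a dominant region are walls of its pseudomaximal alcove. -/
theorem IsCeiling.isSimpleAt [Finite ι] (hP : IsEuclidean P) [P.IsCrystallographic]
    [P.IsReduced] (hv : ∀ α, ⟪v, P.root α⟫_ℝ = b.height α)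
    (hR : IsDominantRegion b k R) (hxR : x ∈ R) (hx : x ∉ affineArrangement P)
    (hirr : ∀ α, IsIrreducibleAt P (-v) x α → (α, level P x α) ∈ truncatedRoots b k) {α : ι}
    {r : ℕ} (hα : b.IsPos α) (hr : r ≤ k) (h : IsCeiling P R α r) :
    IsSimpleAt P x (negRoot P (α, (r : ℤ))) := by
  have hlev0 := hR.level_nonneg hxR hα
  have hlev : level P x α + 1 = r := by
    apply le_antisymm
    · have h1 : (level P x α : ℝ) < r :=
        (Int.floor_le _).trans_lt (h.2.2 x hxR)
      have h2 : level P x α < r := by exact_mod_cast h1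
      omega
    -- Otherwise `R` lies below a Catalan hyperplane of `α` of offset less than `r`, and its closure
    -- cannot reach the ceiling.
    · by_contra! hlt
      obtain ⟨y, hy, hyr⟩ := h.2.1.exists_mem_closure
      have h1 := affineRoot_level_pos hx (P.reflectionPerm α α)
      have h2 := affineRoot_nonneg_of_mem_closure (fun y hy => hR.1.affineRoot_pos hxR hy
        (by simp only [level_neg hx, abs_le]; omega) h1) hy
      simp only [level_neg hx, affineRoot, root_negIndex, inner_neg_right, hyr] at h2
      have h3 : (level P x α : ℝ) + 1 < r := by exact_mod_cast hlt
      push_cast at h2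
      linarith
  have hα' : b.height (P.reflectionPerm α α) < 0 := by
    have : 0 < b.height α := hα
    rw [height_negIndex]; omega
  have hlev' : level P x (P.reflectionPerm α α) = -(r : ℤ) := by
    rw [level_neg hx]; omega
  have hpair : negRoot P (α, (r : ℤ)) =
      (P.reflectionPerm α α, level P x (P.reflectionPerm α α)) := by
    rw [hlev']; rfl
  have hwall : IsWall P R (P.reflectionPerm α α) (level P x (P.reflectionPerm α α)) := by
    have hH : hyperplane P (P.reflectionPerm α α) (level P x (P.reflectionPerm α α)) =
        hyperplane P α r := by
      ext y
      simp only [hyperplane, Set.mem_ofPred_eq, hlev', root_negIndex, inner_neg_right]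
      push_cast
      exact neg_inj
    have h1 := h.2.1
    rw [IsWall, ← hH] at h1
    exact h1
  have hr0 := h.1
  rw [hpair]
  refine IsWall.isSimpleAt hP (inner_neg_ne_zero hv) hR.1 hxR hx hirr
    ((inner_neg_pos_iff hv).mpr hα') hwall ?_ ?_
  · intro β γ hβ hγ e hl
    have h1 := hR.level_neg_of_height_neg hxR hx ((inner_neg_pos_iff hv).mp hβ)
    have h2 := hR.level_neg_of_height_neg hxR hx ((inner_neg_pos_iff hv).mp hγ)
    rw [abs_le]
    omega
  · intro β γ hγ e hl hβ
    rw [inner_neg_pos_iff hv] at hγ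
    have h2 := hR.level_neg_of_height_neg hxR hx hγ
    rw [mem_truncatedRoots_iff_of_root_eq_add hα' hγ e] at hβ
    refine ⟨hβ, ?_⟩
    rw [abs_le] at hβ ⊢
    omega

end Highest

/-! ### Moving regions by the longest element -/

/-- The elements of `M` share a strict sign at the origin, which nonempty sums inherit. A linear
root, being zero there, is thus excluded from the cone of `M`. -/
theorem eq_zero_or_pos_of_mem_addSubmonoidClosure {M : Set (ι × ℤ)} {c : ℝ}
    (hc : ∀ p ∈ M, 0 < c * affineRoot P p 0) {f : V → ℝ}
    (hf : f ∈ AddSubmonoid.closure (affineRoot P '' M)) : f = 0 ∨ 0 < c * f 0 := by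
  induction hf using AddSubmonoid.closure_induction with
  | mem f hf => obtain ⟨p, hp, rfl⟩ := hf; exact Or.inr (hc p hp)
  | zero => exact Or.inl rfl
  | add f g _ _ hf hg =>
    rcases hf with rfl | hf <;> rcases hg with rfl | hg
    · simp
    · right; simpa using hg
    · right; simpa using hf
    · right
      rw [Pi.add_apply, mul_add]
      exact add_pos hf hg

section Transfer

variable [Finite ι] [FiniteDimensional ℝ V] [P.IsCrystallographic]

/-- The region of the image of `x` under the longest element of the group generated by the
reflections in the simple affine roots of `M`. -/
theorem IsDominantRegion.sideSet_longest (hP : IsEuclidean P) {b : P.Base} {k : ℕ} {R : Set V}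
    (hR : IsDominantRegion b k R) {x : V} (hxR : x ∈ R) (hx : x ∉ affineArrangement P)
    {M : Set (ι × ℤ)} (hMk : M ⊆ catalanRoots ι k) (hM : ∀ p ∈ M, IsSimpleAt P x p) {v : V}
    (hv : ∀ p ∈ M, 0 < ⟪v, P.root p.1⟫_ℝ) {c : ℝ} (hc : ∀ p ∈ M, 0 < c * affineRoot P p 0)
    {w : Equiv.Perm V} (hw : IsLongest (wallReflection P '' M) w) :
    IsDominantRegion b k (sideSet P (catalanRoots ι k) (w x)) ∧
      ∀ p ∈ M, IsWall P (sideSet P (catalanRoots ι k) (w x)) p.1 p.2 ∧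
        ∀ y ∈ sideSet P (catalanRoots ι k) (w x), affineRoot P p y < 0 := by
  have hfin := (catalanRoots_finite k).subset hMk
  have hwx := apply_notMem_affineArrangement hP (closure_le_affineWeylGroup M hw.1) hx
  have hreg := isRegion_sideSet (k := k) (notMem_catalanArrangement hwx)
  refine ⟨⟨hreg, fun α hα y hy => ?_⟩, fun p hp => ⟨?_, fun y hy => ?_⟩⟩
  · have h0 : ((α, 0) : ι × ℤ) ∈ catalanRoots ι k := by simp [catalanRoots]
    have h1 : 0 < affineRoot P (α, 0) x := by simpa [affineRoot] using hR.2 α hα x hxR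
    have h2 : 0 < affineRoot P (α, 0) (w x) := by
      -- A linear root separating `x` from `w x` would be a sum of elements of `M`, yet it vanishes
      -- at the origin.
      refine affineRoot_pos_of_not_neg hwx fun hneg => ?_
      have h3 := mem_addSubmonoidClosure_of_mem_span hP hx hfin hM hv
        (mem_span_of_separates hP hx hM hw.1 h1 hneg) h1
      rcases eq_zero_or_pos_of_mem_addSubmonoidClosure hc h3 with h4 | h4
      · exact h1.ne' (congrFun h4 x)
      · simp [affineRoot] at h4
    simpa [affineRoot] using hy _ h0 h2
  · have h1 := (hw.isSimpleAt_negRoot hP hx hfin hM hv hp).isWall hP hwx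
    refine ⟨Set.disjoint_left.mpr fun y hy hy' => ?_, ?_⟩
    · exact hreg.affineRoot_ne_zero hy (hMk hp) (sub_eq_zero.mpr hy')
    · apply subset_antisymm
      · exact affineSpan_le (Q := hyperplaneSubspace P p.1 p.2).mpr Set.inter_subset_right
      · have h2 := h1.2
        rw [hyperplane_negRoot] at h2
        conv_lhs => rw [← h2]
        exact affineSpan_mono ℝ (Set.inter_subset_inter_left _
          (closure_mono (cell_subset_sideSet hwx _)))
  · have h1 := hy _ (negRoot_mem_catalanRoots (P := P) (hMk hp)) (by
      rw [affineRoot_negRoot]; linarith [hw.forall_neg hP hx hM hp])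
    rw [affineRoot_negRoot] at h1
    linarith

/-- Moving back by the longest element. -/
theorem apply_mem_sideSet_of_mem_sideSet (hP : IsEuclidean P) {k : ℕ} {x y : V}
    (hx : x ∉ affineArrangement P) (hy : y ∉ affineArrangement P) {M M' : Set (ι × ℤ)}
    (hMfin : M.Finite) (hMfin' : M'.Finite)
    (hM : ∀ p ∈ M, IsSimpleAt P x p) (hM' : ∀ p ∈ M', IsSimpleAt P y p)
    (hneg : ∀ p ∈ M, negRoot P p ∈ M') (hneg' : ∀ p ∈ M', negRoot P p ∈ M) {v : V}
    (hv : ∀ p ∈ M, 0 < ⟪v, P.root p.1⟫_ℝ) {w : Equiv.Perm V}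
    (hw : IsLongest (wallReflection P '' M) w) (hw' : IsLongest (wallReflection P '' M') w)
    (hyx : y ∈ sideSet P (catalanRoots ι k) (w x)) :
    w y ∈ sideSet P (catalanRoots ι k) x := by
  have hwx := apply_notMem_affineArrangement hP (closure_le_affineWeylGroup M hw.1) hx
  have hwy := apply_notMem_affineArrangement hP (closure_le_affineWeylGroup M hw.1) hy
  have hv' : ∀ p ∈ M', 0 < ⟪-v, P.root p.1⟫_ℝ := by
    intro p hp
    have h1 := hv _ (hneg' p hp)
    simp only [negRoot, root_negIndex, inner_neg_right] at h1
    rwa [inner_neg_left]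
  have flip : ∀ {z : V} {M M' : Set (ι × ℤ)}, (∀ p ∈ M', negRoot P p ∈ M) →
      (∀ p ∈ M, 0 < affineRoot P p z) → ∀ p ∈ M', affineRoot P p z < 0 := by
    intro z M M' h h' p hp
    have := h' _ (h p hp)
    rw [affineRoot_negRoot] at this
    linarith
  intro p hp hpx
  refine affineRoot_pos_of_not_neg hwy fun hpwy => ?_
  -- If `p` is positive at `w x`, it is so at `y` and separates `y` from `w y`, so it is a sum from
  -- `M'` and nonpositive at `x`. Otherwise it separates `x` from `w x`, so it is a sum from `M` and
  -- nonnegative at `w y`.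
  by_cases hpwx : 0 < affineRoot P p (w x)
  · have hpy := hyx p hp hpwx
    have h1 := mem_addSubmonoidClosure_of_mem_span hP hy hMfin' hM' hv'
      (mem_span_of_separates hP hy hM' hw'.1 hpy hpwy) hpy
    exact hpx.not_ge (nonpos_of_mem_addSubmonoidClosure
      (flip hneg' fun p hp => (hM p hp).1) h1)
  · have h1 := mem_addSubmonoidClosure_of_mem_span hP hx hMfin hM hv
      (mem_span_of_separates hP hx hM hw.1 hpx (affineRoot_neg_of_not_pos hwx hpwx)) hpx
    refine hpwy.not_ge (nonneg_of_mem_addSubmonoidClosure (fun p hp => ?_) h1)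
    have := hw'.forall_neg hP hy hM' (hneg p hp)
    rw [affineRoot_negRoot] at this
    linarith

end Transfer

/-! ### The bijection -/

/-- The affine roots attached to a set of hyperplanes `H_α^i` with `i` a natural number. -/
def affineRootsOf (M : Set (ι × ℕ)) : Set (ι × ℤ) := (fun p => (p.1, (p.2 : ℤ))) '' M

theorem reflectionsIn_eq_image (M : Set (ι × ℕ)) :
    reflectionsIn P M = wallReflection P '' affineRootsOf M := by
  rw [affineRootsOf, Set.image_image]
  rfl

theorem reflectionsIn_eq_image_negRoot (M : Set (ι × ℕ)) :
    reflectionsIn P M = wallReflection P '' (negRoot P '' affineRootsOf M) := by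
  rw [Set.image_image, reflectionsIn_eq_image]
  exact Set.image_congr fun p _ => (wallReflection_negRoot p).symm

theorem finiteDimensional_of_isRootSystem (P : RootPairing ι ℝ V N) [Finite ι] [P.IsRootSystem] :
    FiniteDimensional ℝ V :=
  ⟨by
    rw [← RootPairing.IsRootSystem.span_root_eq_top (P := P)]
    exact Submodule.fg_span (Set.finite_range _)⟩

end CatalanArrangement

open CatalanArrangement in
theorem theorem1 {ι V N : Type*} [Finite ι] [NormedAddCommGroup V] [InnerProductSpace ℝ V]
    [AddCommGroup N] [Module ℝ N] (P : RootPairing ι ℝ V N)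
    [P.IsRootSystem] [P.IsCrystallographic] [P.IsReduced] (hP : IsEuclidean P)
    (b : P.Base) (k : ℕ) (hk : 0 < k) (M : Set (ι × ℕ))
    (hM : ∀ p ∈ M, b.IsPos p.1 ∧ 1 ≤ p.2 ∧ p.2 ≤ k) :
    ∃ Θ : regionsAbove b k M ≃ regionsBelow b k M,
      (regionsAbove b k M).Nonempty →
        IsParabolic b (Subgroup.closure (reflectionsIn P M)) ∧
        Finite (Subgroup.closure (reflectionsIn P M)) ∧
        ∃ w₀ : Equiv.Perm V,
          (∀ w, IsLongest (reflectionsIn P M) w ↔ w = w₀) ∧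
          (∀ R : regionsAbove b k M,
            IsAlcove P (minimalAlcove b k R) ∧
            minimalAlcove b k R ⊆ (R : Set V) ∧
            IsAlcove P (w₀ '' minimalAlcove b k R) ∧
            w₀ '' minimalAlcove b k R ⊆ (Θ R : Set V)) ∧
          (∀ R' : regionsBelow b k M,
            IsAlcove P (pseudomaximalAlcove b k R') ∧
            pseudomaximalAlcove b k R' ⊆ (R' : Set V) ∧
            IsAlcove P (w₀ '' pseudomaximalAlcove b k R') ∧
            w₀ '' pseudomaximalAlcove b k R' ⊆ (Θ.symm R' : Set V)) := by
  have := finiteDimensional_of_isRootSystem P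
  obtain ⟨v, hv⟩ := exists_inner_eq_height b
  set M₁ : Set (ι × ℤ) := affineRootsOf M with hM₁
  set M₂ : Set (ι × ℤ) := negRoot P '' M₁ with hM₂
  have e₁ : reflectionsIn P M = wallReflection P '' M₁ := reflectionsIn_eq_image M
  have e₂ : reflectionsIn P M = wallReflection P '' M₂ := reflectionsIn_eq_image_negRoot M
  have hk₁ : M₁ ⊆ catalanRoots ι k := by
    rintro _ ⟨p, hp, rfl⟩
    have := (hM p hp).2.2
    simpa [catalanRoots] using this
  have hk₂ : M₂ ⊆ catalanRoots ι k := by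
    rintro _ ⟨p, hp, rfl⟩
    exact negRoot_mem_catalanRoots (hk₁ hp)
  have hv₁ : ∀ p ∈ M₁, 0 < ⟪v, P.root p.1⟫_ℝ := by
    rintro _ ⟨p, hp, rfl⟩
    exact (isPos_iff_inner_pos hv).mp (hM p hp).1
  have hv₂ : ∀ p ∈ M₂, 0 < ⟪-v, P.root p.1⟫_ℝ := by
    rintro _ ⟨p, hp, rfl⟩
    simpa only [negRoot, root_negIndex, inner_neg_right, inner_neg_left, neg_neg] using hv₁ p hp
  have hc₁ : ∀ p ∈ M₁, 0 < (-1 : ℝ) * affineRoot P p 0 := by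
    rintro _ ⟨p, hp, rfl⟩
    have : 0 < p.2 := (hM p hp).2.1
    simpa [affineRoot] using this
  have hc₂ : ∀ p ∈ M₂, 0 < (1 : ℝ) * affineRoot P p 0 := by
    rintro _ ⟨p, hp, rfl⟩
    rw [affineRoot_negRoot]
    linarith [hc₁ p hp]
  have hneg : ∀ p ∈ M₁, negRoot P p ∈ M₂ := fun p hp => ⟨p, hp, rfl⟩
  have hneg' : ∀ p ∈ M₂, negRoot P p ∈ M₁ := by
    rintro _ ⟨p, hp, rfl⟩
    rwa [negRoot_negRoot]
  have hfin₁ := (catalanRoots_finite k).subset hk₁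
  have hfin₂ := (catalanRoots_finite k).subset hk₂
  have hup : ∀ R : regionsAbove b k M, ∃ x ∈ R.1, x ∉ affineArrangement P ∧
      minimalAlcove b k R.1 = cell P x ∧ ∀ p ∈ M₁, IsSimpleAt P x p := by
    rintro ⟨R, hR, hfloor⟩
    obtain ⟨x, hxR, hx, hirr⟩ := hR.exists_lowest hP hv
    refine ⟨x, hxR, hx, minimalAlcove_eq_cell hv hR hxR hx hirr, ?_⟩
    rintro _ ⟨p, hp, rfl⟩
    exact (hfloor p hp).isSimpleAt hP hv hR hxR hx hirr (hM p hp).1 (hM p hp).2.2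
  have hlow : ∀ R : regionsBelow b k M, ∃ y ∈ R.1, y ∉ affineArrangement P ∧
      pseudomaximalAlcove b k R.1 = cell P y ∧ ∀ p ∈ M₂, IsSimpleAt P y p := by
    rintro ⟨R, hR, hceil⟩
    obtain ⟨y, hyR, hyσ, hy, hirr⟩ := hR.exists_highest hP hv
    refine ⟨y, hyR, hy, pseudomaximalAlcove_eq_cell hv hR hyR hy hyσ hirr, ?_⟩
    rintro _ ⟨_, ⟨p, hp, rfl⟩, rfl⟩
    exact (hceil p hp).isSimpleAt hP hv hR hyR hy hirr (hM p hp).1 (hM p hp).2.2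
  choose x hxR hx hxcell hxM using hup
  choose y hyR hy hycell hyM using hlow
  -- The longest element can be built from a region on either side; if both sides are empty, there
  -- is nothing to match.
  by_cases hne : Nonempty (regionsAbove b k M) ∨ Nonempty (regionsBelow b k M)
  swap
  · rw [not_or, not_nonempty_iff, not_nonempty_iff] at hne
    have := hne.1
    have := hne.2
    exact ⟨Equiv.equivOfIsEmpty _ _, fun h => (hne.1.false ⟨_, h.some_mem⟩).elim⟩
  obtain ⟨w₀, hw₀⟩ : ∃ w₀, ∀ w, IsLongest (reflectionsIn P M) w ↔ w = w₀ := by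
    rcases hne with hne | hne
    · have R := hne.some
      rw [e₁]
      exact exists_longest hP (hx R) hfin₁ (hxM R) hv₁
    · have R := hne.some
      rw [e₂]
      exact exists_longest hP (hy R) hfin₂ (hyM R) hv₂
  have hlong := (hw₀ w₀).mpr rfl
  have hlong₁ : IsLongest (wallReflection P '' M₁) w₀ := e₁ ▸ hlong
  have hlong₂ : IsLongest (wallReflection P '' M₂) w₀ := e₂ ▸ hlong
  have hw₀W := closure_le_affineWeylGroup M₁ hlong₁.1
  have hdown : ∀ R, sideSet P (catalanRoots ι k) (w₀ (x R)) ∈ regionsBelow b k M := by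
    intro R
    obtain ⟨h1, h2⟩ := R.2.1.sideSet_longest hP (hxR R) (hx R) hk₁ (hxM R) hv₁ hc₁ hlong₁
    refine ⟨h1, fun p hp => ?_⟩
    obtain ⟨h3, h4⟩ := h2 (p.1, (p.2 : ℤ)) ⟨p, hp, rfl⟩
    exact ⟨(hM p hp).2.1, h3, fun z hz => by simpa [affineRoot] using h4 z hz⟩
  have hback : ∀ R, sideSet P (catalanRoots ι k) (w₀ (y R)) ∈ regionsAbove b k M := by
    intro R
    obtain ⟨h1, h2⟩ := R.2.1.sideSet_longest hP (hyR R) (hy R) hk₂ (hyM R) hv₂ hc₂ hlong₂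
    refine ⟨h1, fun p hp => ?_⟩
    obtain ⟨h3, h4⟩ := h2 _ (hneg (p.1, (p.2 : ℤ)) ⟨p, hp, rfl⟩)
    refine ⟨(hM p hp).2.1, ?_, fun z hz => ?_⟩
    · have hH : hyperplane P (negRoot P (p.1, (p.2 : ℤ))).1 (negRoot P (p.1, (p.2 : ℤ))).2 =
          hyperplane P p.1 p.2 := hyperplane_negRoot _
      rw [IsWall, hH] at h3
      exact h3
    · have h5 := h4 z hz
      rw [affineRoot_negRoot] at h5
      simpa [affineRoot] using h5
  let Θ : regionsAbove b k M ≃ regionsBelow b k M :=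
    { toFun := fun R => ⟨_, hdown R⟩
      invFun := fun R => ⟨_, hback R⟩
      left_inv := by
        intro R
        apply Subtype.ext
        -- The pseudomaximal alcove of the image is not assumed to be `w₀` of the minimal alcove;
        -- lying in the same region with the opposite simple affine roots suffices.
        have h1 := apply_mem_sideSet_of_mem_sideSet hP (hx R) (hy ⟨_, hdown R⟩) hfin₁ hfin₂
          (hxM R) (hyM _) hneg hneg' hv₁ hlong₁ hlong₂ (hyR ⟨_, hdown R⟩)
        rw [← R.2.1.1.eq_sideSet (hxR R)] at h1
        exact (R.2.1.1.eq_sideSet h1).symm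
      right_inv := by
        intro R
        apply Subtype.ext
        have h1 := apply_mem_sideSet_of_mem_sideSet hP (hy R) (hx ⟨_, hback R⟩) hfin₂ hfin₁
          (hyM R) (hxM _) hneg' hneg hv₂ hlong₂ hlong₁ (hxR ⟨_, hback R⟩)
        rw [← R.2.1.1.eq_sideSet (hyR R)] at h1
        exact (R.2.1.1.eq_sideSet h1).symm }
  refine ⟨Θ, fun ⟨R₀, hR₀⟩ => ⟨?_, ?_, w₀, hw₀, fun R => ?_, fun R => ?_⟩⟩
  · rw [e₁]
    exact isParabolic_closure hP b (hx ⟨R₀, hR₀⟩) (hxM ⟨R₀, hR₀⟩)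
  · rw [e₁]
    exact finite_closure hP (hx ⟨R₀, hR₀⟩) (hxM ⟨R₀, hR₀⟩) hv₁
  · have hwx := apply_notMem_affineArrangement hP hw₀W (hx R)
    rw [hxcell R, image_cell hP hw₀W (hx R)]
    refine ⟨isAlcove_cell (hx R), ?_, isAlcove_cell hwx, cell_subset_sideSet hwx _⟩
    conv_rhs => rw [R.2.1.1.eq_sideSet (hxR R)]
    exact cell_subset_sideSet (hx R) _
  · have hwy := apply_notMem_affineArrangement hP hw₀W (hy R)
    rw [hycell R, image_cell hP hw₀W (hy R)]
    refine ⟨isAlcove_cell (hy R), ?_, isAlcove_cell hwy, cell_subset_sideSet hwy _⟩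
    conv_rhs => rw [R.2.1.1.eq_sideSet (hyR R)]
    exact cell_subset_sideSet (hy R) _
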